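/- Let $(\Omega,\mathcal F,P)$ be a probability space. All equalities between sub-$\sigma$-fields of $\mathcal F$, and the word "generate", are understood modulo $P$-null sets. Let $(\mathcal F_{s,t})_{s\le t}$ ($s,t\in\mathbb R$) be a continuous factorization of it, that is, a family of sub-$\sigma$-fields of $\mathcal F$ such that (a) for $r\le s\le t$, $\mathcal F_{r,s}$ and $\mathcal F_{s,t}$ are independent and together generate $\mathcal F_{r,t}$; (b) for $s<t$, the $\sigma$-field $\mathcal F_{s,t}$ is generated by $\bigcup_{\varepsilon>0}\mathcal F_{s+\varepsilon,t-\varepsilon}$ (over those $\varepsilon$ with $s+\varepsilon\le t-\varepsilon$); (c) $\bigcup_{n\ge1}\mathcal F_{-n,n}$ generates $\mathcal F$. For an elementary set $E\subset\mathbb R$ (a finite union of intervals) let $\mathcal F_E$ be the $\sigma$-field generated by all $\mathcal F_{s,t}$ with $s<t$ and $(s,t)\subset E$. Let $\mathcal C$ be the space of all compact subsets of $\mathbb R$ (including $\emptyset$) with the Borel $\sigma$-field of the Hausdorff metric. A spectral measure of $f\in L_2(\Omega,\mathcal F,P)$ (real-valued) is a measure $\mu_f$ on $\mathcal C$ such that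 $$\mu_f\big(\{M\in\mathcal C: M\subset E\}\big)=\big\|\mathbb E(f\mid\mathcal F_E)\big\|_{L_2}^2\quad\text{for all elementary sets }E .$$ Then every $f\in L_2(\Omega,\mathcal F,P)$ has exactly one spectral measure. Call $f$ stable if $\mu_f$ is concentrated on finite sets $M$, and sensitive if $\mu_f$ is concentrated on infinite sets $M$. Let the first chaos be the set of all $f\in L_2(\Omega,\mathcal F,P)$ such that $\mu_f$ is concentrated on $\{M\in\mathcal C:|M|=1\}$. There exists a sub-$\sigma$-field $\mathcal F_{\mathrm{stable}}\subset\mathcal F$ (unique modulo null sets) such that, for all $f\in L_2(\Omega,\mathcal F,P)$, $f$ is stable if and only if $f$ is (almost surely equal to) an $\mathcal F_{\mathrm{stable}}$-measurable function, and $f$ is sensitive if and only if $\mathbb E(f\mid\mathcal F_{\mathrm{stable}})=0$ almost surely; and the sub-$\sigma$-field generated by the first chaos is equal to $\mathcal F_{\mathrm{stable}}$. -/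

import Mathlib

open MeasureTheory ProbabilityTheory TopologicalSpace

/-- The space of compact subsets of `ℝ` (including the empty set), with Mathlib's Vietoris
(= Hausdorff metric) topology, carries its Borel σ-field. -/
instance instMeasurableSpaceCompactsReal : MeasurableSpace (Compacts ℝ) := borel (Compacts ℝ)

instance instBorelSpaceCompactsReal : BorelSpace (Compacts ℝ) := ⟨rfl⟩

/-- Two σ-fields agree modulo `P`-null sets: each member of either one is almost surely equal to a
member of the other one. -/
def EqModNull {Ω : Type*} {m₀ : MeasurableSpace Ω} (P : Measure Ω) (m₁ m₂ : MeasurableSpace Ω) : Prop :=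
  (∀ A, MeasurableSet[m₁] A → ∃ B, MeasurableSet[m₂] B ∧ A =ᵐ[P] B) ∧
    (∀ B, MeasurableSet[m₂] B → ∃ A, MeasurableSet[m₁] A ∧ B =ᵐ[P] A)

/-- A continuous factorization (over `ℝ`) of the probability space `(Ω, P)`: the σ-fields
`field s t`, `s ≤ t` (values for `t < s` are irrelevant). Equalities of σ-fields, and the word
"generates", are understood modulo `P`-null sets. -/
structure ContinuousFactorization {Ω : Type*} {m₀ : MeasurableSpace Ω} (P : Measure Ω) where
  /-- The σ-field `𝓕_{s,t}`. -/
  field : ℝ → ℝ → MeasurableSpace Ω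
  field_le : ∀ s t, s ≤ t → field s t ≤ m₀
  indep : ∀ r s t, r ≤ s → s ≤ t → Indep (field r s) (field s t) P
  generate : ∀ r s t, r ≤ s → s ≤ t → EqModNull P (field r s ⊔ field s t) (field r t)
  continuous : ∀ s t, s < t →
    EqModNull P (⨆ (ε : ℝ) (_ : 0 < ε) (_ : s + ε ≤ t - ε), field (s + ε) (t - ε)) (field s t)
  exhaust : EqModNull P (⨆ (n : ℕ) (_ : 1 ≤ n), field (-(n : ℝ)) n) m₀

/-- An elementary set: a finite union of intervals of any kind (open, closed, half-open, bounded or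
not; a subset of `ℝ` is an interval if and only if it is order-connected). -/
def IsElementary (E : Set ℝ) : Prop :=
  ∃ I : Set (Set ℝ), I.Finite ∧ (∀ J ∈ I, J.OrdConnected) ∧ E = ⋃₀ I

/-- `{M : M ⊆ E}` as a set of compact sets. -/
def compactsIn (E : Set ℝ) : Set (Compacts ℝ) := {M | (M : Set ℝ) ⊆ E}

namespace ContinuousFactorization

variable {Ω : Type*} {m₀ : MeasurableSpace Ω} {P : Measure Ω}

/-- The σ-field `𝓕_E`, generated by all `𝓕_{s,t}` with `(s,t) ⊆ E`. For an elementary set with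
components `(s₁,t₁), …, (sₙ,tₙ)` (modulo a finite set) it is
`𝓕_{s₁,t₁} ⊗ ⋯ ⊗ 𝓕_{sₙ,tₙ}`, with `𝓕_{-∞,t}` generated by the `𝓕_{-n,t}`, and so on. -/
def fieldOn (X : ContinuousFactorization P) (E : Set ℝ) : MeasurableSpace Ω :=
  ⨆ (s : ℝ) (t : ℝ) (_ : s < t) (_ : Set.Ioo s t ⊆ E), X.field s t

theorem fieldOn_le (X : ContinuousFactorization P) (E : Set ℝ) : X.fieldOn E ≤ m₀ :=
  iSup_le fun s => iSup_le fun t => iSup_le fun h => iSup_le fun _ => X.field_le s t h.le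

/-- `μ` is the spectral measure of `f`: it satisfies `μ {M : M ⊆ E} = ‖𝔼(f | 𝓕_E)‖²` for all
elementary sets `E` (it is finite: take `E = ℝ`). -/
def IsSpectralMeasure (X : ContinuousFactorization P) (f : Lp ℝ 2 P)
    (μ : Measure (Compacts ℝ)) : Prop :=
  ∀ E : Set ℝ, IsElementary E → μ (compactsIn E) = eLpNorm (P[f | X.fieldOn E]) 2 P ^ 2

/-- The subspace `H_𝓜` of `L₂` that corresponds to a Borel set `𝓜` of compact sets: all `f` whose
spectral measure is concentrated on `𝓜`. -/
def spectralSubspace (X : ContinuousFactorization P) (𝓜 : Set (Compacts ℝ)) : Set (Lp ℝ 2 P) :=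
  {f | ∃ μ : Measure (Compacts ℝ), X.IsSpectralMeasure f μ ∧ μ 𝓜ᶜ = 0}

/-- The `n`-th chaos, corresponding to the compact sets with exactly `n` points. -/
def chaos (X : ContinuousFactorization P) (n : ℕ) : Set (Lp ℝ 2 P) :=
  X.spectralSubspace {M | (M : Set ℝ).encard = n}

/-- Stable elements of `L₂`: the spectral measure is concentrated on finite sets. -/
def IsStable (X : ContinuousFactorization P) (f : Lp ℝ 2 P) : Prop :=
  f ∈ X.spectralSubspace {M | (M : Set ℝ).Finite}

/-- Sensitive elements of `L₂`: the spectral measure is concentrated on infinite sets. -/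
def IsSensitive (X : ContinuousFactorization P) (f : Lp ℝ 2 P) : Prop :=
  f ∈ X.spectralSubspace {M | (M : Set ℝ).Infinite}

/-- `G` is the stable σ-field `𝓕_stable` (it is determined modulo null sets). -/
structure IsStableField (X : ContinuousFactorization P) (G : MeasurableSpace Ω) : Prop where
  le : G ≤ m₀
  stable_iff : ∀ f : Lp ℝ 2 P, X.IsStable f ↔ AEStronglyMeasurable[G] f P
  sensitive_iff : ∀ f : Lp ℝ 2 P, X.IsSensitive f ↔ P[f | G] =ᵐ[P] 0

end ContinuousFactorization

/-- The sub-σ-field generated by a set `S` of elements of `L₂`. As these are equivalence classes, it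
is generated by all measurable sets that coincide almost surely with `{f ∈ B}` for some `f ∈ S` and
some Borel set `B`. -/
def generatedField {Ω : Type*} {m₀ : MeasurableSpace Ω} {P : Measure Ω} (S : Set (Lp ℝ 2 P)) :
    MeasurableSpace Ω :=
  MeasurableSpace.generateFrom
    {A | MeasurableSet[m₀] A ∧ ∃ f ∈ S, ∃ B : Set ℝ, MeasurableSet B ∧ A =ᵐ[P] (f ⁻¹' B : Set Ω)}

/-! σ-fields over disjoint sets are independent, so the projections onto L₂(𝓕_E) commute and compose
as intersections (`proj_proj`). Over a finite family of disjoint cells, the numbers ‖𝔼(f|𝓕_E)‖² are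
therefore cumulative sums of nonnegative weights (`exists_weights`). Placing these weights on finer
and finer grids and passing to the limit along an ultrafilter gives a content on the space of
compact sets, and its measure is μ_f. Uniqueness holds because the events {M ⊆ E} form a π-system
generating the Borel σ-field (`borel_compacts_eq`).

The stable elements form a closed subspace of L₂ containing the constants, so it is L₂ of a
sub-σ-field as soon as |f| is stable whenever f is (`exists_measurableSpace_of_abs_mem`). Since
|𝔼(f|𝓕_E)| ≤ 𝔼(|f| | 𝓕_E), the measure of |f| dominates that of f on each {M ⊆ E}, with the same
total mass. Keep every grid cell independently with probability a: all cells hit by M survive with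
probability a to the number of hit cells, so this power is a positive combination of indicators of
events {M ⊆ E}, and its integral can only grow from f to |f|. Refining the grid kills infinite M
when a < 1, and then a → 1 shows that |f| has at least as much mass on finite sets as f
(`finite_ae_of_compactsIn_le`). Sensitive elements are the orthogonal complement of the stable ones.

The first chaos is stable, so it generates no more than the stable σ-field. Conversely, finite sets
are exhausted by sets with at most one point in each cell of some grid. If M has at most one point
in c, then, after subtraction of 𝔼(f|𝓕_{cᶜ}), partial integration of f over 𝓕_{cᶜ} lands in the
first chaos; hence f is measurable with respect to (first chaos on c) ∨ 𝓕_{cᶜ}. Independence allows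
such reductions to be combined cell by cell (`condExp_sup_of_indep`, `aestronglyMeasurable_biUnion`)
until only first-chaos σ-fields remain. -/

open Filter Set
open scoped Topology ENNReal NNReal InnerProductSpace

/-! ### σ-fields modulo null sets, independence and conditional expectation. -/

section NullCompletion

variable {Ω : Type*} {m m' m₁ m₂ : MeasurableSpace Ω} {m₀ : MeasurableSpace Ω} {P : Measure Ω}

/-- The completion of a sub-σ-field by the null sets of the ambient σ-field. -/
@[reducible]
def nullCompletion (P : Measure Ω) (m : MeasurableSpace Ω) : MeasurableSpace Ω :=
  eventuallyMeasurableSpace m (ae P) ⊓ m₀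

theorem measurableSet_nullCompletion {A : Set Ω} :
    MeasurableSet[nullCompletion P m] A ↔
      MeasurableSet[m₀] A ∧ ∃ B, MeasurableSet[m] B ∧ A =ᵐ[P] B :=
  MeasurableSpace.measurableSet_inf.trans and_comm

theorem nullCompletion_le : nullCompletion P m ≤ m₀ := inf_le_right

theorem le_nullCompletion (hm : m ≤ m₀) : m ≤ nullCompletion P m := fun A hA =>
  measurableSet_nullCompletion.2 ⟨hm _ hA, A, hA, EventuallyEq.rfl⟩

theorem nullCompletion_le_of_le (h : m ≤ nullCompletion P m') :
    nullCompletion P m ≤ nullCompletion P m' := fun A hA => by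
  obtain ⟨hA0, B, hB, hAB⟩ := measurableSet_nullCompletion.1 hA
  obtain ⟨-, C, hC, hBC⟩ := measurableSet_nullCompletion.1 (h _ hB)
  exact measurableSet_nullCompletion.2 ⟨hA0, C, hC, hAB.trans hBC⟩

theorem nullCompletion_mono (hm : m' ≤ m₀) (h : m ≤ m') :
    nullCompletion P m ≤ nullCompletion P m' :=
  nullCompletion_le_of_le (h.trans (le_nullCompletion hm))

theorem EqModNull.le_left (h : EqModNull P m₁ m₂) (h₁ : m₁ ≤ m₀) : m₁ ≤ nullCompletion P m₂ :=
  fun _ hA => measurableSet_nullCompletion.2 ⟨h₁ _ hA, h.1 _ hA⟩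

theorem EqModNull.le_right (h : EqModNull P m₁ m₂) (h₂ : m₂ ≤ m₀) : m₂ ≤ nullCompletion P m₁ :=
  fun _ hA => measurableSet_nullCompletion.2 ⟨h₂ _ hA, h.2 _ hA⟩

theorem eqModNull_of_le (h₁ : m₁ ≤ nullCompletion P m₂) (h₂ : m₂ ≤ nullCompletion P m₁) :
    EqModNull P m₁ m₂ :=
  ⟨fun _ hA => (measurableSet_nullCompletion.1 (h₁ _ hA)).2,
    fun _ hA => (measurableSet_nullCompletion.1 (h₂ _ hA)).2⟩

theorem ProbabilityTheory.Indep.of_le_nullCompletion (h : Indep m₁ m₂ P)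
    (h₁ : m ≤ nullCompletion P m₁) (h₂ : m' ≤ nullCompletion P m₂) : Indep m m' P := by
  rw [Indep_iff] at h ⊢
  intro s t hs ht
  obtain ⟨-, s', hs', hss⟩ := measurableSet_nullCompletion.1 (h₁ _ hs)
  obtain ⟨-, t', ht', htt⟩ := measurableSet_nullCompletion.1 (h₂ _ ht)
  rw [measure_congr (hss.inter htt), measure_congr hss, measure_congr htt, h _ _ hs' ht']

theorem condExp_nullCompletion [IsFiniteMeasure P] (hm : m ≤ m₀) {f : Ω → ℝ}
    (hf : Integrable f P) : P[f | nullCompletion P m] =ᵐ[P] P[f | m] := by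
  symm
  refine ae_eq_condExp_of_forall_setIntegral_eq nullCompletion_le hf
    (fun _ _ _ => integrable_condExp.integrableOn) (fun s hs _ => ?_)
    (stronglyMeasurable_condExp.mono (le_nullCompletion hm)).aestronglyMeasurable
  obtain ⟨-, t, ht, hst⟩ := measurableSet_nullCompletion.1 hs
  rw [setIntegral_congr_set hst, setIntegral_congr_set hst, setIntegral_condExp hm hf ht]

theorem aestronglyMeasurable_iff_condExp [IsFiniteMeasure P] (hm : m ≤ m₀) {f : Ω → ℝ}
    (hf : Integrable f P) : AEStronglyMeasurable[m] f P ↔ P[f | m] =ᵐ[P] f :=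
  ⟨fun h => condExp_of_aestronglyMeasurable' hm h hf,
    fun h => stronglyMeasurable_condExp.aestronglyMeasurable.congr h⟩

theorem MeasureTheory.AEStronglyMeasurable.of_le_nullCompletion [IsFiniteMeasure P]
    (hm' : m' ≤ m₀) (h : m ≤ nullCompletion P m') {f : Ω → ℝ} (hf : Integrable f P)
    (hfm : AEStronglyMeasurable[m] f P) : AEStronglyMeasurable[m'] f P := by
  rw [aestronglyMeasurable_iff_condExp hm' hf]
  refine (condExp_nullCompletion hm' hf).symm.trans ?_
  exact condExp_of_aestronglyMeasurable' nullCompletion_le (hfm.mono h) hf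

/-- A π-λ argument: both set integrals are σ-additive, and `univ ∈ S` takes care of complements. -/
theorem ae_eq_condExp_of_isPiSystem [IsFiniteMeasure P] (hm : m ≤ m₀) {S : Set (Set Ω)}
    (hS : m = MeasurableSpace.generateFrom S) (hpi : IsPiSystem S) (hu : univ ∈ S)
    {f g : Ω → ℝ} (hf : Integrable f P) (hg : Integrable g P) (hgm : AEStronglyMeasurable[m] g P)
    (h : ∀ s ∈ S, ∫ ω in s, g ω ∂P = ∫ ω in s, f ω ∂P) : g =ᵐ[P] P[f | m] := by
  refine ae_eq_condExp_of_forall_setIntegral_eq hm hf (fun _ _ _ => hg.integrableOn) ?_ hgm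
  intro s hs _
  induction s, hs using MeasurableSpace.induction_on_inter hS hpi with
  | empty => simp
  | basic t ht => exact h t ht
  | compl t ht ih =>
    have hu' := h _ hu
    rw [setIntegral_univ, setIntegral_univ] at hu'
    rw [setIntegral_compl (hm _ ht) hg, setIntegral_compl (hm _ ht) hf, ih (measure_lt_top _ _), hu']
  | iUnion t hd ht ih =>
    rw [integral_iUnion (fun i => hm _ (ht i)) hd hg.integrableOn,
      integral_iUnion (fun i => hm _ (ht i)) hd hf.integrableOn]
    exact tsum_congr fun i => ih i (measure_lt_top _ _)

/-- The π-system of intersections `a ∩ b`, with `a` from the first and `b` from the second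
σ-field. -/
def interSets (m₁ m₂ : MeasurableSpace Ω) : Set (Set Ω) :=
  image2 (· ∩ ·) {a | MeasurableSet[m₁] a} {b | MeasurableSet[m₂] b}

theorem isPiSystem_interSets : IsPiSystem (interSets m₁ m₂) := by
  rintro _ ⟨a, ha, b, hb, rfl⟩ _ ⟨a', ha', b', hb', rfl⟩ -
  exact ⟨a ∩ a', MeasurableSet.inter ha ha', b ∩ b', MeasurableSet.inter hb hb', by
    simp only []; rw [inter_inter_inter_comm]⟩

theorem univ_mem_interSets : univ ∈ interSets m₁ m₂ :=
  ⟨univ, MeasurableSet.univ, univ, MeasurableSet.univ, by simp⟩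

theorem sup_eq_generateFrom_interSets :
    m₁ ⊔ m₂ = MeasurableSpace.generateFrom (interSets m₁ m₂) := by
  apply le_antisymm
  · refine sup_le (fun a ha => ?_) (fun b hb => ?_)
    · exact MeasurableSpace.measurableSet_generateFrom
        ⟨a, ha, univ, MeasurableSet.univ, by simp⟩
    · exact MeasurableSpace.measurableSet_generateFrom
        ⟨univ, MeasurableSet.univ, b, hb, by simp⟩
  · refine MeasurableSpace.generateFrom_le ?_
    rintro _ ⟨a, ha, b, hb, rfl⟩
    exact MeasurableSet.inter ((le_sup_left : m₁ ≤ m₁ ⊔ m₂) _ ha)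
      ((le_sup_right : m₂ ≤ m₁ ⊔ m₂) _ hb)

/-- Independence of `a₁ ∨ a₂` and `b₁ ∨ b₂`, if `a₁, b₁` live on one of two independent
σ-fields, and `a₂, b₂` on the other one. -/
theorem indep_sup_sup [IsProbabilityMeasure P] {a₁ b₁ a₂ b₂ : MeasurableSpace Ω}
    (h : Indep m₁ m₂ P) (ha₁ : a₁ ≤ nullCompletion P m₁) (hb₁ : b₁ ≤ nullCompletion P m₁)
    (ha₂ : a₂ ≤ nullCompletion P m₂) (hb₂ : b₂ ≤ nullCompletion P m₂)
    (h₁ : Indep a₁ b₁ P) (h₂ : Indep a₂ b₂ P) : Indep (a₁ ⊔ a₂) (b₁ ⊔ b₂) P := by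
  have h' : Indep (nullCompletion P m₁) (nullCompletion P m₂) P :=
    h.of_le_nullCompletion le_rfl le_rfl
  refine IndepSets.indep
    (sup_le (ha₁.trans nullCompletion_le) (ha₂.trans nullCompletion_le))
    (sup_le (hb₁.trans nullCompletion_le) (hb₂.trans nullCompletion_le))
    isPiSystem_interSets isPiSystem_interSets sup_eq_generateFrom_interSets
    sup_eq_generateFrom_interSets ?_
  rw [IndepSets_iff]
  rw [Indep_iff] at h₁ h₂ h'
  rintro _ _ ⟨s, hs, t, ht, rfl⟩ ⟨u, hu, v, hv, rfl⟩
  simp only [mem_ofPred_eq] at hs ht hu hv ⊢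
  rw [inter_inter_inter_comm, h' _ _ (MeasurableSet.inter (ha₁ _ hs) (hb₁ _ hu))
    (MeasurableSet.inter (ha₂ _ ht) (hb₂ _ hv)), h₁ _ _ hs hu, h₂ _ _ ht hv,
    h' _ _ (ha₁ _ hs) (ha₂ _ ht), h' _ _ (hb₁ _ hu) (hb₂ _ hv)]
  ring

theorem setIntegral_of_indep [IsProbabilityMeasure P] {A B : MeasurableSpace Ω} (hA : A ≤ m₀)
    (hB : B ≤ m₀) (h : Indep A B P) {f : Ω → ℝ} (hf : Integrable f P)
    (hfA : StronglyMeasurable[A] f) {b : Set Ω} (hb : MeasurableSet[B] b) :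
    ∫ ω in b, f ω ∂P = P.real b * ∫ ω, f ω ∂P := by
  rw [← setIntegral_condExp hB hf hb, setIntegral_congr_ae (hB _ hb)
    ((condExp_indep_eq hA hB hfA h).mono fun ω hω _ => hω)]
  simp

theorem integral_mul_condExp [IsFiniteMeasure P] (hm : m ≤ m₀) {f g : Ω → ℝ}
    (hf : AEStronglyMeasurable[m] f P) (hg : Integrable g P) (hfg : Integrable (f * g) P) :
    ∫ ω, f ω * (P[g | m]) ω ∂P = ∫ ω, f ω * g ω ∂P := by
  have h := condExp_mul_of_aestronglyMeasurable_left hf hfg hg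
  calc ∫ ω, f ω * (P[g | m]) ω ∂P = ∫ ω, (P[f * g | m]) ω ∂P := (integral_congr_ae h).symm
    _ = _ := integral_condExp hm

theorem condExp_indicator_inter_of_indep [IsProbabilityMeasure P] {A A' B : MeasurableSpace Ω}
    (hA : A ≤ m₀) (hB : B ≤ m₀) (h : Indep A B P) (hA' : A' ≤ A) {a b : Set Ω}
    (ha : MeasurableSet[A] a) (hb : MeasurableSet[B] b) :
    b.indicator (P[a.indicator 1 | A']) =ᵐ[P]
      P[(a ∩ b).indicator (1 : Ω → ℝ) | A' ⊔ B] := by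
  have hA'0 := hA'.trans hA
  have hint : ∀ s, MeasurableSet[m₀] s → Integrable (s.indicator (1 : Ω → ℝ)) P := fun s hs =>
    (integrable_const (1 : ℝ)).indicator hs
  refine ae_eq_condExp_of_isPiSystem (sup_le hA'0 hB) sup_eq_generateFrom_interSets
    isPiSystem_interSets univ_mem_interSets (hint _ ((hA _ ha).inter (hB _ hb)))
    (integrable_condExp.indicator (hB _ hb)) ?_ ?_
  · refine StronglyMeasurable.aestronglyMeasurable ?_
    exact (stronglyMeasurable_condExp.mono (le_sup_left : A' ≤ A' ⊔ B)).indicator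
      ((le_sup_right : B ≤ A' ⊔ B) _ hb)
  · rintro _ ⟨s, hs, t, ht, rfl⟩
    simp only [mem_ofPred_eq] at hs ht ⊢
    have hs0 := hA'0 _ hs
    have ht0 := hB _ ht
    have hb0 := hB _ hb
    have ha0 := hA _ ha
    rw [setIntegral_indicator hb0, inter_assoc, inter_comm, ← setIntegral_indicator hs0,
      setIntegral_of_indep hA hB h (integrable_condExp.indicator hs0)
        ((stronglyMeasurable_condExp.mono hA').indicator (hA' _ hs)) (MeasurableSet.inter ht hb),
      integral_indicator hs0, setIntegral_condExp hA'0 (hint _ ha0) hs,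
      setIntegral_indicator ha0, setIntegral_indicator (ha0.inter hb0)]
    have e : s ∩ t ∩ (a ∩ b) = (s ∩ a) ∩ (t ∩ b) := inter_inter_inter_comm _ _ _ _
    rw [Indep_iff] at h
    simp only [Pi.one_apply, integral_const, Measure.restrict_apply_univ,
      smul_eq_mul, mul_one, e, measureReal_def]
    rw [h _ _ (MeasurableSet.inter (hA' _ hs) ha) (MeasurableSet.inter ht hb), ENNReal.toReal_mul,
      mul_comm]

/-- The tool for discarding information: if f does not need all of A, then adding the rest of A to
A' ∨ B' predicts nothing more. With B' = ⊥ it integrates out B; if f is also A ∨ B'-measurable, it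
makes f measurable with respect to A' ∨ B'. -/
theorem condExp_sup_of_indep [IsProbabilityMeasure P] {A A' B B' : MeasurableSpace Ω}
    (hA : A ≤ m₀) (hB : B ≤ m₀) (h : Indep A B P) (hA' : A' ≤ A) (hB' : B' ≤ B) {f : Ω → ℝ}
    (hf : Integrable f P) (hfm : AEStronglyMeasurable[A' ⊔ B] f P) :
    P[f | A' ⊔ B'] =ᵐ[P] P[f | A ⊔ B'] := by
  have hA'0 := hA'.trans hA
  have hB'0 := hB'.trans hB
  refine ae_eq_condExp_of_isPiSystem (sup_le hA hB'0) sup_eq_generateFrom_interSets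
    isPiSystem_interSets univ_mem_interSets hf integrable_condExp
    (stronglyMeasurable_condExp.mono (sup_le_sup_right hA' B')).aestronglyMeasurable ?_
  rintro _ ⟨a, ha, b, hb, rfl⟩
  simp only [mem_ofPred_eq] at ha hb ⊢
  have hab : MeasurableSet[m₀] (a ∩ b) := (hA _ ha).inter (hB'0 _ hb)
  have hint : Integrable ((a ∩ b).indicator (1 : Ω → ℝ)) P :=
    (integrable_const (1 : ℝ)).indicator hab
  -- Against an A' ∨ B-measurable g, the indicator of a ∩ b may be replaced by its conditional
  -- expectation on A' ∨ B, and by independence this is 1_b 𝔼(1_a|A'). That function is already A' ∨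
  -- B'-measurable, so it cannot tell f from 𝔼(f|A' ∨ B').
  have key : ∀ g : Ω → ℝ, Integrable g P → AEStronglyMeasurable[A' ⊔ B] g P →
      ∫ ω in a ∩ b, g ω ∂P = ∫ ω, g ω * b.indicator (P[a.indicator 1 | A']) ω ∂P := by
    intro g hg hgm
    have e : (fun ω => g ω * (a ∩ b).indicator (1 : Ω → ℝ) ω) = (a ∩ b).indicator g := by
      ext ω; by_cases hω : ω ∈ a ∩ b <;> simp [hω]
    have h1 := integral_mul_condExp (sup_le hA'0 hB) hgm hint
      (by rw [Pi.mul_def, e]; exact hg.indicator hab)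
    rw [e, integral_indicator hab] at h1
    rw [← h1]
    refine integral_congr_ae ?_
    filter_upwards [condExp_indicator_inter_of_indep hA hB h hA' ha (hB' _ hb)] with ω hω
    rw [hω]
  rw [key f hf hfm, key _ integrable_condExp
    (stronglyMeasurable_condExp.mono (sup_le_sup_left hB' A')).aestronglyMeasurable]
  have hu : StronglyMeasurable[A' ⊔ B'] (b.indicator (P[a.indicator (1 : Ω → ℝ) | A'])) :=
    (stronglyMeasurable_condExp.mono (le_sup_left : A' ≤ A' ⊔ B')).indicator
      ((le_sup_right : B' ≤ A' ⊔ B') _ hb)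
  have hbd : ∀ᵐ ω ∂P, ‖b.indicator (P[a.indicator (1 : Ω → ℝ) | A']) ω‖ ≤ 1 := by
    have := ae_bdd_norm_condExp_of_ae_bdd_norm (m := A') (μ := P) (R := 1)
      (f := a.indicator (1 : Ω → ℝ)) (ae_of_all _ fun ω => by
        by_cases hω : ω ∈ a <;> simp [hω])
    filter_upwards [this] with ω hω
    by_cases hω' : ω ∈ b <;> simp [hω']; simpa using hω
  have := integral_mul_condExp (sup_le hA'0 hB'0) hu.aestronglyMeasurable hf
    (by
      have := hf.bdd_mul (c := 1)
        (hu.mono (sup_le hA'0 hB'0)).aestronglyMeasurable hbd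
      exact this)
  simpa only [mul_comm] using this

end NullCompletion

/-! ### Conditional expectation as an orthogonal projection in L₂. -/

section CondProj

variable {Ω : Type*} {m m' m₁ m₂ : MeasurableSpace Ω} {m₀ : MeasurableSpace Ω} {P : Measure Ω}

/-- Conditional expectation as an operator on `L₂`. -/
noncomputable def condProj (P : Measure Ω) (hm : m ≤ m₀) : Lp ℝ 2 P →L[ℝ] Lp ℝ 2 P :=
  (lpMeas ℝ ℝ m 2 P).subtypeL ∘L condExpL2 ℝ ℝ hm

theorem aestronglyMeasurable_condProj (hm : m ≤ m₀) (f : Lp ℝ 2 P) :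
    AEStronglyMeasurable[m] (condProj P hm f) P :=
  aestronglyMeasurable_condExpL2 hm f

theorem inner_condProj_left (hm : m ≤ m₀) (f g : Lp ℝ 2 P) :
    ⟪condProj P hm f, g⟫_ℝ = ⟪f, condProj P hm g⟫_ℝ :=
  inner_condExpL2_left_eq_right hm

theorem norm_condProj_le (hm : m ≤ m₀) (f : Lp ℝ 2 P) : ‖condProj P hm f‖ ≤ ‖f‖ :=
  norm_condExpL2_coe_le hm f

theorem inner_eq_integral (f g : Lp ℝ 2 P) : ⟪f, g⟫_ℝ = ∫ ω, f ω * g ω ∂P := by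
  rw [L2.inner_def]
  refine integral_congr_ae (ae_of_all _ fun ω => ?_)
  simp [mul_comm]

variable [IsProbabilityMeasure P]

theorem integrable_of_L2 (f : Lp ℝ 2 P) : Integrable f P := (Lp.memLp f).integrable (by norm_num)

theorem coeFn_condProj (hm : m ≤ m₀) (f : Lp ℝ 2 P) : condProj P hm f =ᵐ[P] P[f | m] := by
  have h := (Lp.memLp f).condExpL2_ae_eq_condExp (𝕜 := ℝ) hm
  rw [Lp.toLp_coeFn] at h
  exact h

theorem condProj_eq_iff (hm : m ≤ m₀) {f g : Lp ℝ 2 P} :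
    condProj P hm f = g ↔ P[f | m] =ᵐ[P] g :=
  ⟨fun h => h ▸ (coeFn_condProj hm f).symm, fun h => Lp.ext ((coeFn_condProj hm f).trans h)⟩

theorem condProj_eq_self_iff (hm : m ≤ m₀) {f : Lp ℝ 2 P} :
    condProj P hm f = f ↔ AEStronglyMeasurable[m] f P := by
  rw [condProj_eq_iff, aestronglyMeasurable_iff_condExp hm (integrable_of_L2 f)]

theorem condProj_condProj_of_le (hm : m ≤ m₀) (hm' : m' ≤ m₀) (h : m ≤ nullCompletion P m')
    (f : Lp ℝ 2 P) : condProj P hm' (condProj P hm f) = condProj P hm f :=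
  (condProj_eq_self_iff hm').2
    ((aestronglyMeasurable_condProj hm f).of_le_nullCompletion hm' h (integrable_of_L2 _))

theorem condProj_condProj_of_le' (hm : m ≤ m₀) (hm' : m' ≤ m₀) (h : m ≤ nullCompletion P m')
    (f : Lp ℝ 2 P) : condProj P hm (condProj P hm' f) = condProj P hm f := by
  refine ext_inner_right ℝ fun g => ?_
  rw [inner_condProj_left, inner_condProj_left, condProj_condProj_of_le hm hm' h,
    ← inner_condProj_left]

theorem inner_condProj_self (hm : m ≤ m₀) (f : Lp ℝ 2 P) :
    ⟪condProj P hm f, f⟫_ℝ = ‖condProj P hm f‖ ^ 2 := by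
  rw [← real_inner_self_eq_norm_sq, inner_condProj_left hm f (condProj P hm f),
    condProj_condProj_of_le hm hm (le_nullCompletion hm), inner_condProj_left]

theorem norm_condProj_mono (hm : m ≤ m₀) (hm' : m' ≤ m₀) (h : m ≤ nullCompletion P m')
    (f : Lp ℝ 2 P) : ‖condProj P hm f‖ ≤ ‖condProj P hm' f‖ := by
  rw [← condProj_condProj_of_le' hm hm' h]
  exact norm_condProj_le hm _

theorem condProj_congr (hm : m ≤ m₀) (hm' : m' ≤ m₀) (h : m ≤ nullCompletion P m')
    (h' : m' ≤ nullCompletion P m) (f : Lp ℝ 2 P) : condProj P hm f = condProj P hm' f := by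
  rw [← condProj_condProj_of_le hm hm' h, condProj_condProj_of_le' hm' hm h']

theorem norm_sub_condProj_sq (hm : m ≤ m₀) (f : Lp ℝ 2 P) :
    ‖f - condProj P hm f‖ ^ 2 = ‖f‖ ^ 2 - ‖condProj P hm f‖ ^ 2 := by
  rw [norm_sub_sq_real, real_inner_comm, inner_condProj_self]
  ring

theorem eLpNorm_condExp_sq (hm : m ≤ m₀) (f : Lp ℝ 2 P) :
    eLpNorm (P[f | m]) 2 P ^ 2 = ENNReal.ofReal (‖condProj P hm f‖ ^ 2) := by
  rw [← eLpNorm_congr_ae (coeFn_condProj hm f), ENNReal.ofReal_pow (norm_nonneg _),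
    ofReal_norm, Lp.enorm_def]

/-- Conditional expectations with respect to an increasing sequence of σ-fields converge. -/
theorem tendsto_norm_condProj {𝓕 : ℕ → MeasurableSpace Ω} (hle : ∀ n, 𝓕 n ≤ m₀) (hmono : Monotone 𝓕)
    (hm : m ≤ m₀) (h₁ : ∀ n, 𝓕 n ≤ nullCompletion P m) (h₂ : m ≤ nullCompletion P (⨆ n, 𝓕 n))
    (f : Lp ℝ 2 P) :
    Tendsto (fun n => ‖condProj P (hle n) f‖) atTop (𝓝 ‖condProj P hm f‖) := by
  have hmn : Monotone fun n => ‖condProj P (hle n) f‖ := fun i j hij =>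
    norm_condProj_mono (hle i) (hle j) ((hmono hij).trans (le_nullCompletion (hle j))) f
  have hbd : ∀ n, ‖condProj P (hle n) f‖ ≤ ‖condProj P hm f‖ := fun n =>
    norm_condProj_mono (hle n) hm (h₁ n) f
  have hsup : ⨆ n, 𝓕 n ≤ m₀ := iSup_le hle
  let ℱ : Filtration ℕ m₀ := ⟨𝓕, hmono, hle⟩
  obtain ⟨l, hl⟩ : ∃ l, Tendsto (fun n => ‖condProj P (hle n) f‖) atTop (𝓝 l) :=
    ⟨_, tendsto_atTop_ciSup hmn ⟨_, by rintro _ ⟨n, rfl⟩; exact hbd n⟩⟩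
  suffices h : ‖condProj P hm f‖ ≤ l by
    have : l = ‖condProj P hm f‖ := le_antisymm (le_of_tendsto' hl hbd) h
    rwa [this] at hl
  have e : ∀ n, eLpNorm (P[f | 𝓕 n]) 2 P = ENNReal.ofReal ‖condProj P (hle n) f‖ := fun n => by
    rw [← eLpNorm_congr_ae (coeFn_condProj (hle n) f), ofReal_norm, Lp.enorm_def]
  -- The norms increase and are bounded by the target, so only lower semicontinuity is missing:
  -- Fatou, with almost sure martingale convergence.
  have hlim := Lp.eLpNorm_lim_le_liminf_eLpNorm (p := 2) (μ := P)
    (f := fun n => P[f | 𝓕 n]) (fun n => (stronglyMeasurable_condExp.mono (hle n)).aestronglyMeasurable)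
    (P[f | ⨆ n, 𝓕 n]) (tendsto_ae_condExp (ℱ := ℱ) f)
  simp only [e] at hlim
  rw [(ENNReal.tendsto_ofReal hl).liminf_eq, ← eLpNorm_congr_ae (coeFn_condProj hsup f),
    ← Lp.enorm_def, ← ofReal_norm] at hlim
  have hl0 : 0 ≤ l := ge_of_tendsto' hl fun n => norm_nonneg _
  exact (norm_condProj_mono hm hsup h₂ f).trans ((ENNReal.ofReal_le_ofReal_iff hl0).1 hlim)

end CondProj

/-! ### Sets of reals with constant one-sided germs. -/

section Tame

/-- A set is eventually constant along a filter. -/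
def GermConst (l : Filter ℝ) (E : Set ℝ) : Prop := (∀ᶠ y in l, y ∈ E) ∨ ∀ᶠ y in l, y ∉ E

/-- A set of reals is tame if it is constant on a one-sided punctured neighbourhood, on each side,
of each point. -/
def IsTame (E : Set ℝ) : Prop := ∀ x, GermConst (𝓝[>] x) E ∧ GermConst (𝓝[<] x) E

theorem GermConst.compl {l : Filter ℝ} {E : Set ℝ} (h : GermConst l E) : GermConst l Eᶜ := by
  rcases h with h | h
  · exact Or.inr (h.mono fun y hy => by simpa using hy)
  · exact Or.inl h

theorem GermConst.inter {l : Filter ℝ} {E F : Set ℝ} (h : GermConst l E) (h' : GermConst l F) :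
    GermConst l (E ∩ F) := by
  rcases h with h | h
  · rcases h' with h' | h'
    · exact Or.inl (h.and h')
    · exact Or.inr (h'.mono fun y hy hy' => hy hy'.2)
  · exact Or.inr (h.mono fun y hy hy' => hy hy'.1)

namespace IsTame

variable {E F : Set ℝ}

theorem compl (h : IsTame E) : IsTame Eᶜ := fun x => ⟨(h x).1.compl, (h x).2.compl⟩

theorem inter (h : IsTame E) (h' : IsTame F) : IsTame (E ∩ F) :=
  fun x => ⟨(h x).1.inter (h' x).1, (h x).2.inter (h' x).2⟩

theorem union (h : IsTame E) (h' : IsTame F) : IsTame (E ∪ F) := by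
  have := (h.compl.inter h'.compl).compl
  rwa [← compl_union, compl_compl] at this

theorem diff (h : IsTame E) (h' : IsTame F) : IsTame (E \ F) := h.inter h'.compl

theorem empty : IsTame ∅ := fun _ => ⟨Or.inr (by simp), Or.inr (by simp)⟩

theorem univ : IsTame univ := by simpa using empty.compl

theorem of_ordConnected (h : E.OrdConnected) : IsTame E := by
  refine fun x => ⟨?_, ?_⟩
  · by_cases hf : ∃ᶠ y in 𝓝[>] x, y ∈ E
    · obtain ⟨b, hbE, hb⟩ := (hf.and_eventually self_mem_nhdsWithin).exists
      refine Or.inl ?_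
      filter_upwards [Ioo_mem_nhdsGT hb] with y hy
      obtain ⟨a, haE, ha⟩ := (hf.and_eventually (Ioo_mem_nhdsGT hy.1)).exists
      exact h.out haE hbE ⟨ha.2.le, hy.2.le⟩
    · exact Or.inr (not_frequently.1 hf)
  · by_cases hf : ∃ᶠ y in 𝓝[<] x, y ∈ E
    · obtain ⟨b, hbE, hb⟩ := (hf.and_eventually self_mem_nhdsWithin).exists
      refine Or.inl ?_
      filter_upwards [Ioo_mem_nhdsLT hb] with y hy
      obtain ⟨a, haE, ha⟩ := (hf.and_eventually (Ioo_mem_nhdsLT hy.2)).exists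
      exact h.out hbE haE ⟨hy.1.le, ha.1.le⟩
    · exact Or.inr (not_frequently.1 hf)

theorem biUnion {ι : Type*} (s : Finset ι) {D : ι → Set ℝ} (h : ∀ i ∈ s, IsTame (D i)) :
    IsTame (⋃ i ∈ s, D i) := by
  classical
  induction s using Finset.induction_on with
  | empty => simpa using empty
  | insert a s ha ih =>
    rw [Finset.set_biUnion_insert]
    exact (h a (by simp)).union (ih fun i hi => h i (by simp [hi]))

theorem exists_Ioo (h : IsTame E) (x : ℝ) :
    (∀ᶠ y in 𝓝[>] x, Ioo x y ⊆ E ∨ Disjoint (Ioo x y) E) ∧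
      ∀ᶠ y in 𝓝[<] x, Ioo y x ⊆ E ∨ Disjoint (Ioo y x) E := by
  have hr : ∀ F : Set ℝ, (∀ᶠ y in 𝓝[>] x, y ∈ F) → ∀ᶠ y in 𝓝[>] x, Ioo x y ⊆ F := by
    intro F hF
    obtain ⟨u, hu, huF⟩ := mem_nhdsGT_iff_exists_Ioo_subset.1 hF
    filter_upwards [Ioo_mem_nhdsGT hu] with y hy
    exact (Ioo_subset_Ioo_right hy.2.le).trans huF
  have hl : ∀ F : Set ℝ, (∀ᶠ y in 𝓝[<] x, y ∈ F) → ∀ᶠ y in 𝓝[<] x, Ioo y x ⊆ F := by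
    intro F hF
    obtain ⟨u, hu, huF⟩ := mem_nhdsLT_iff_exists_Ioo_subset.1 hF
    filter_upwards [Ioo_mem_nhdsLT hu] with y hy
    exact (Ioo_subset_Ioo_left hy.1.le).trans huF
  constructor
  · rcases (h x).1 with h1 | h1
    · exact (hr _ h1).mono fun y hy => Or.inl hy
    · exact (hr Eᶜ h1).mono fun y hy => Or.inr (disjoint_left.2 hy)
  · rcases (h x).2 with h1 | h1
    · exact (hl _ h1).mono fun y hy => Or.inl hy
    · exact (hl Eᶜ h1).mono fun y hy => Or.inr (disjoint_left.2 hy)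

end IsTame

theorem IsElementary.isTame {E : Set ℝ} (h : IsElementary E) : IsTame E := by
  obtain ⟨I, hI, hJ, rfl⟩ := h
  have := IsTame.biUnion hI.toFinset (D := id)
    fun J hJ' => IsTame.of_ordConnected (hJ J (hI.mem_toFinset.1 hJ'))
  simpa [sUnion_eq_biUnion] using this

/-- A property of intervals that is inherited by concatenations, and holds for small intervals on
either side of each point, holds for all intervals. -/
theorem interval_induction {p : ℝ → ℝ → Prop}
    (htrans : ∀ a b c, a < b → b < c → p a b → p b c → p a c)
    (hr : ∀ x, ∀ᶠ y in 𝓝[>] x, p x y) (hl : ∀ x, ∀ᶠ y in 𝓝[<] x, p y x) {a b : ℝ} (hab : a < b) :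
    p a b := by
  set S : Set ℝ := {x | a < x ∧ x ≤ b ∧ p a x}
  obtain ⟨x₀, hx₀, hx₀'⟩ := ((hr a).and (Ioo_mem_nhdsGT hab)).exists
  have hx₀S : x₀ ∈ S := ⟨hx₀'.1, hx₀'.2.le, hx₀⟩
  have hbdd : BddAbove S := ⟨b, fun x hx => hx.2.1⟩
  set c := sSup S
  have hac : a < c := hx₀'.1.trans_le (le_csSup hbdd hx₀S)
  have hcb : c ≤ b := csSup_le ⟨x₀, hx₀S⟩ fun x hx => hx.2.1
  have hpc : p a c := by
    obtain ⟨u, hu, hup⟩ := mem_nhdsLT_iff_exists_Ioo_subset.1 (hl c)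
    obtain ⟨x, hxS, hux⟩ := exists_lt_of_lt_csSup ⟨x₀, hx₀S⟩ (show u < sSup S from hu)
    rcases (le_csSup hbdd hxS).eq_or_lt with h | h
    · have : x = c := h
      rw [← this]; exact hxS.2.2
    · exact htrans a x c hxS.1 h hxS.2.2 (hup ⟨hux, h⟩)
  rcases hcb.eq_or_lt with h | h
  · rwa [← h]
  · obtain ⟨y, hy, hy'⟩ := ((hr c).and (Ioo_mem_nhdsGT h)).exists
    exact absurd (le_csSup hbdd ⟨hac.trans hy'.1, hy'.2.le, htrans a c y hac hy'.1 hpc hy⟩)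
      (not_le.2 hy'.1)

end Tame

/-! ### The σ-fields 𝓕_E for tame sets and the commuting projections. -/

namespace ContinuousFactorization

variable {Ω : Type*} {m : MeasurableSpace Ω} {m₀ : MeasurableSpace Ω} {P : Measure Ω}
  (X : ContinuousFactorization P)

theorem field_sup_le {r s t : ℝ} (h : r ≤ s) (h' : s ≤ t) :
    X.field r s ⊔ X.field s t ≤ nullCompletion P (X.field r t) :=
  (X.generate r s t h h').le_left (sup_le (X.field_le _ _ h) (X.field_le _ _ h'))

theorem field_le_sup {r s t : ℝ} (h : r ≤ s) (h' : s ≤ t) :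
    X.field r t ≤ nullCompletion P (X.field r s ⊔ X.field s t) :=
  (X.generate r s t h h').le_right (X.field_le _ _ (h.trans h'))

theorem field_mono {a s t b : ℝ} (h₁ : a ≤ s) (h₂ : s ≤ t) (h₃ : t ≤ b) :
    X.field s t ≤ nullCompletion P (X.field a b) :=
  (le_sup_left.trans (X.field_sup_le h₂ h₃)).trans
    (nullCompletion_le_of_le (le_sup_right.trans (X.field_sup_le h₁ (h₂.trans h₃))))

variable {E F : Set ℝ}

theorem field_le_fieldOn {s t : ℝ} (h : s < t) (hE : Ioo s t ⊆ E) : X.field s t ≤ X.fieldOn E :=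
  le_iSup₂_of_le s t (le_iSup₂_of_le h hE le_rfl)

theorem fieldOn_le_of (h : ∀ s t, s < t → Ioo s t ⊆ E → X.field s t ≤ m) : X.fieldOn E ≤ m :=
  iSup₂_le fun s t => iSup₂_le fun h₁ h₂ => h s t h₁ h₂

theorem fieldOn_mono (h : E ⊆ F) : X.fieldOn E ≤ X.fieldOn F :=
  X.fieldOn_le_of fun _ _ h₁ h₂ => X.field_le_fieldOn h₁ (h₂.trans h)

theorem fieldOn_mono' (h : E ⊆ F) : X.fieldOn E ≤ nullCompletion P (X.fieldOn F) :=
  (X.fieldOn_mono h).trans (le_nullCompletion (X.fieldOn_le F))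

theorem fieldOn_empty : X.fieldOn ∅ = ⊥ :=
  le_bot_iff.1 <| X.fieldOn_le_of fun s t h h' => by
    obtain ⟨x, hx⟩ := nonempty_Ioo.2 h
    exact (h' hx).elim

theorem fieldOn_Ioo_le {a b : ℝ} : X.fieldOn (Ioo a b) ≤ nullCompletion P (X.field a b) :=
  X.fieldOn_le_of fun s t h₁ h₂ => by
    obtain ⟨h, h'⟩ := (Ioo_subset_Ioo_iff h₁).1 h₂
    exact X.field_mono h h₁.le h'

/-- `𝓕_E` is contained in a σ-field, if `𝓕_{s,t}` is for all small intervals in `E` with a given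
endpoint. -/
theorem fieldOn_le_nullCompletion
    (hr : ∀ x, ∀ᶠ y in 𝓝[>] x, Ioo x y ⊆ E → X.field x y ≤ nullCompletion P m)
    (hl : ∀ x, ∀ᶠ y in 𝓝[<] x, Ioo y x ⊆ E → X.field y x ≤ nullCompletion P m) :
    X.fieldOn E ≤ nullCompletion P m := by
  refine X.fieldOn_le_of fun s t h₁ => ?_
  refine interval_induction (p := fun a b => Ioo a b ⊆ E → X.field a b ≤ nullCompletion P m)
    (fun a b c hab hbc h h' hac => ?_) hr hl h₁
  refine (X.field_le_sup hab.le hbc.le).trans (nullCompletion_le_of_le (sup_le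
    (h ((Ioo_subset_Ioo_right hbc.le).trans hac)) (h' ((Ioo_subset_Ioo_left hab.le).trans hac))))

/-- Tameness is essential here: for the rationals and the irrationals both σ-fields on the right are
trivial. A short one-sided interval inside E ∪ F is either inside E or misses E, and then it is
inside F. -/
theorem fieldOn_union_le (hE : IsTame E) (hF : IsTame F) :
    X.fieldOn (E ∪ F) ≤ nullCompletion P (X.fieldOn E ⊔ X.fieldOn F) := by
  have hle := le_nullCompletion (P := P) (sup_le (X.fieldOn_le E) (X.fieldOn_le F))
  have key : ∀ s t : ℝ, s < t → (Ioo s t ⊆ E ∨ Disjoint (Ioo s t) E) →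
      (Ioo s t ⊆ F ∨ Disjoint (Ioo s t) F) → Ioo s t ⊆ E ∪ F →
        X.field s t ≤ nullCompletion P (X.fieldOn E ⊔ X.fieldOn F) := by
    rintro s t hst (h | h) h' hEF
    · exact (X.field_le_fieldOn hst h).trans (le_sup_left.trans hle)
    · exact (X.field_le_fieldOn hst (h.subset_right_of_subset_union hEF)).trans
        (le_sup_right.trans hle)
  refine X.fieldOn_le_nullCompletion (fun x => ?_) (fun x => ?_)
  · filter_upwards [(hE.exists_Ioo x).1, (hF.exists_Ioo x).1, self_mem_nhdsWithin] with y h h' hy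
    exact key x y hy h h'
  · filter_upwards [(hE.exists_Ioo x).2, (hF.exists_Ioo x).2, self_mem_nhdsWithin] with y h h' hy
    exact key y x hy h h'

/-- A short interval inside the closure cannot miss E, because an open set disjoint from E is
disjoint from its closure. -/
theorem fieldOn_closure_le (hE : IsTame E) :
    X.fieldOn (closure E) ≤ nullCompletion P (X.fieldOn E) := by
  have key : ∀ s t : ℝ, s < t → (Ioo s t ⊆ E ∨ Disjoint (Ioo s t) E) → Ioo s t ⊆ closure E →
        X.field s t ≤ nullCompletion P (X.fieldOn E) := by
    rintro s t hst (h | h) hE'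
    · exact (X.field_le_fieldOn hst h).trans (le_nullCompletion (X.fieldOn_le E))
    · obtain ⟨x, hx⟩ := nonempty_Ioo.2 hst
      exact ((h.closure_right isOpen_Ioo).le_bot ⟨hx, hE' hx⟩).elim
  refine X.fieldOn_le_nullCompletion (fun x => ?_) (fun x => ?_)
  · filter_upwards [(hE.exists_Ioo x).1, self_mem_nhdsWithin] with y h hy
    exact key x y hy h
  · filter_upwards [(hE.exists_Ioo x).2, self_mem_nhdsWithin] with y h hy
    exact key y x hy h

theorem fieldOn_inter_Ioo_le {a b c : ℝ} :
    X.fieldOn (E ∩ Ioo a c) ≤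
      nullCompletion P (X.fieldOn (E ∩ Ioo a b) ⊔ X.fieldOn (E ∩ Ioo b c)) := by
  have hle := le_nullCompletion (P := P)
    (sup_le (X.fieldOn_le (E ∩ Ioo a b)) (X.fieldOn_le (E ∩ Ioo b c)))
  refine X.fieldOn_le_of fun s t hst h => ?_
  obtain ⟨hE, hac⟩ := subset_inter_iff.1 h
  obtain ⟨has, htc⟩ := (Ioo_subset_Ioo_iff hst).1 hac
  rcases le_or_gt t b with htb | htb
  · exact (X.field_le_fieldOn hst (subset_inter hE (Ioo_subset_Ioo has htb))).trans
      (le_sup_left.trans hle)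
  rcases le_or_gt b s with hbs | hbs
  · exact (X.field_le_fieldOn hst (subset_inter hE (Ioo_subset_Ioo hbs htc))).trans
      (le_sup_right.trans hle)
  · refine (X.field_le_sup hbs.le htb.le).trans (nullCompletion_le_of_le (sup_le ?_ ?_))
    · exact (X.field_le_fieldOn hbs (subset_inter ((Ioo_subset_Ioo_right htb.le).trans hE)
        (Ioo_subset_Ioo_left has))).trans (le_sup_left.trans hle)
    · exact (X.field_le_fieldOn htb (subset_inter ((Ioo_subset_Ioo_left hbs.le).trans hE)
        (Ioo_subset_Ioo_right htc))).trans (le_sup_right.trans hle)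

theorem fieldOn_eq_iSup :
    X.fieldOn E = ⨆ n : ℕ, X.fieldOn (E ∩ Ioo (-(n : ℝ)) n) := by
  refine le_antisymm (X.fieldOn_le_of fun s t hst h => ?_)
    (iSup_le fun n => X.fieldOn_mono inter_subset_left)
  obtain ⟨n, hn⟩ := exists_nat_ge (max (-s) t)
  refine le_iSup_of_le n (X.field_le_fieldOn hst (subset_inter h (Ioo_subset_Ioo ?_ ?_)))
  · linarith [le_max_left (-s) t]
  · exact (le_max_right _ _).trans hn

theorem monotone_fieldOn_inter :
    Monotone fun n : ℕ => X.fieldOn (E ∩ Ioo (-(n : ℝ)) n) := fun i j hij => by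
  have : (i : ℝ) ≤ j := by exact_mod_cast hij
  exact X.fieldOn_mono (inter_subset_inter_right _ (Ioo_subset_Ioo (neg_le_neg this) this))

/-- On a short interval on one side of a point, one of the two σ-fields is trivial. `indep_sup_sup`
carries independence through concatenation of intervals, and the windows (-n, n) exhaust the line.
-/
theorem indep_fieldOn [IsProbabilityMeasure P] (hE : IsTame E) (hEF : Disjoint E F) :
    Indep (X.fieldOn E) (X.fieldOn F) P := by
  have hbot : ∀ I : Set ℝ, (I ⊆ E ∨ Disjoint I E) →
      Indep (X.fieldOn (E ∩ I)) (X.fieldOn (F ∩ I)) P := by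
    rintro I (h | h)
    · rw [((hEF.mono_left h).symm).inter_eq, fieldOn_empty]
      exact indep_bot_right _
    · rw [h.symm.inter_eq, fieldOn_empty]
      exact indep_bot_left _
  have key : ∀ a b : ℝ, a < b →
      Indep (X.fieldOn (E ∩ Ioo a b)) (X.fieldOn (F ∩ Ioo a b)) P := by
    intro a b
    refine interval_induction (p := fun a b =>
      Indep (X.fieldOn (E ∩ Ioo a b)) (X.fieldOn (F ∩ Ioo a b)) P) (fun a b c hab hbc h₁ h₂ => ?_) (fun x => ?_) (fun x => ?_)
    · have hm : ∀ (G : Set ℝ) (s t : ℝ),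
          X.fieldOn (G ∩ Ioo s t) ≤ nullCompletion P (X.field s t) := fun G s t =>
        (X.fieldOn_mono inter_subset_right).trans X.fieldOn_Ioo_le
      exact (indep_sup_sup (X.indep a b c hab.le hbc.le) (hm E a b) (hm F a b) (hm E b c)
        (hm F b c) h₁ h₂).of_le_nullCompletion X.fieldOn_inter_Ioo_le X.fieldOn_inter_Ioo_le
    · exact (hE.exists_Ioo x).1.mono fun y hy => hbot _ hy
    · exact (hE.exists_Ioo x).2.mono fun y hy => hbot _ hy
  have key' : ∀ n : ℕ, Indep (X.fieldOn (E ∩ Ioo (-(n : ℝ)) n))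
      (X.fieldOn (F ∩ Ioo (-(n : ℝ)) n)) P := by
    intro n
    rcases n.eq_zero_or_pos with rfl | hn
    · refine hbot _ (Or.inl ?_)
      simp
    · have : (0 : ℝ) < n := by exact_mod_cast hn
      exact key _ _ (by linarith)
  rw [X.fieldOn_eq_iSup (E := E), X.fieldOn_eq_iSup (E := F)]
  refine indep_iSup_of_monotone (fun i => ?_) (fun i => X.fieldOn_le _)
    (iSup_le fun i => X.fieldOn_le _) X.monotone_fieldOn_inter
  refine (indep_iSup_of_monotone (fun j => ?_) (fun j => X.fieldOn_le _) (X.fieldOn_le _)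
    X.monotone_fieldOn_inter).symm
  refine (key' (max i j)).symm.of_le_nullCompletion ?_ ?_
  · exact (X.monotone_fieldOn_inter (le_max_right i j)).trans (le_nullCompletion (X.fieldOn_le _))
  · exact (X.monotone_fieldOn_inter (le_max_left i j)).trans (le_nullCompletion (X.fieldOn_le _))

theorem le_fieldOn_univ : m₀ ≤ nullCompletion P (X.fieldOn univ) := by
  refine (X.exhaust.le_right le_rfl).trans (nullCompletion_le_of_le ?_)
  refine iSup₂_le fun n hn => ?_
  have : (1 : ℝ) ≤ n := by exact_mod_cast hn
  exact (X.field_le_fieldOn (by linarith) (subset_univ _)).trans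
    (le_nullCompletion (X.fieldOn_le _))

/-- The operator of conditional expectation given `𝓕_E`. -/
noncomputable def proj (E : Set ℝ) : Lp ℝ 2 P →L[ℝ] Lp ℝ 2 P := condProj P (X.fieldOn_le E)

theorem norm_proj_le (f : Lp ℝ 2 P) : ‖X.proj E f‖ ≤ ‖f‖ := norm_condProj_le _ f

variable [IsProbabilityMeasure P]

/-- By the factorization property at r = s = t this σ-field is independent of itself, hence trivial.
It appears in the continuity axiom when a shrunk interval degenerates to a point. -/
theorem field_self_le (s : ℝ) : X.field s s ≤ nullCompletion P ⊥ := by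
  intro A hA
  have hA0 := X.field_le s s le_rfl _ hA
  have h := (X.indep s s s le_rfl le_rfl)
  rw [Indep_iff] at h
  have h := h A A hA hA
  rw [inter_self] at h
  refine measurableSet_nullCompletion.2 ⟨hA0, ?_⟩
  rcases eq_or_ne (P A) 0 with h0 | h0
  · exact ⟨∅, @MeasurableSet.empty _ ⊥, ae_eq_empty.2 h0⟩
  · refine ⟨univ, @MeasurableSet.univ _ ⊥, ae_eq_univ.2 ?_⟩
    rw [prob_compl_eq_zero_iff hA0]
    have := (ENNReal.mul_eq_left h0 (measure_ne_top P A)).1 h.symm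
    exact this

/-- The continuity axiom, for arbitrary sets: `𝓕_E` is generated by any family of `𝓕_{E'}` that
catches all slightly shrunk subintervals of `E`. -/
theorem fieldOn_le_of_shrink (hm : m ≤ m₀)
    (h : ∀ s t, s < t → Ioo s t ⊆ E → ∀ ε > 0, s + ε < t - ε →
      X.field (s + ε) (t - ε) ≤ nullCompletion P m) :
    X.fieldOn E ≤ nullCompletion P m := by
  refine X.fieldOn_le_of fun s t hst hE => ?_
  refine ((X.continuous s t hst).le_right (X.field_le _ _ hst.le)).trans
    (nullCompletion_le_of_le ?_)
  refine iSup_le fun ε => iSup₂_le fun hε hle => ?_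
  rcases hle.eq_or_lt with h' | h'
  · rw [h']
    exact (X.field_self_le _).trans (nullCompletion_mono hm bot_le)
  · exact h s t hst hE ε hε h'

/-- Split F into E ∩ F and F \ E; the second part is independent of 𝓕_E and is integrated out. -/
theorem proj_proj (hE : IsTame E) (hF : IsTame F) (f : Lp ℝ 2 P) :
    X.proj E (X.proj F f) = X.proj (E ∩ F) f := by
  have h1 : P[X.proj F f | X.fieldOn (E ∩ F) ⊔ ⊥] =ᵐ[P] P[X.proj F f | X.fieldOn E ⊔ ⊥] := by
    refine condExp_sup_of_indep (X.fieldOn_le E) (X.fieldOn_le (F \ E))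
      (X.indep_fieldOn hE disjoint_sdiff_self_right) (X.fieldOn_mono inter_subset_left) bot_le
      (integrable_of_L2 _) ?_
    refine (aestronglyMeasurable_condProj _ f).of_le_nullCompletion
      (sup_le (X.fieldOn_le _) (X.fieldOn_le _)) ?_ (integrable_of_L2 _)
    have := X.fieldOn_union_le (hE.inter hF) (hF.diff hE)
    rwa [inter_comm, inter_union_sdiff, inter_comm] at this
  rw [sup_bot_eq, sup_bot_eq] at h1
  have h2 : X.proj E (X.proj F f) = X.proj (E ∩ F) (X.proj F f) :=
    (condProj_eq_iff _).2 (h1.symm.trans (coeFn_condProj (X.fieldOn_le _) _).symm)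
  rw [h2]
  exact condProj_condProj_of_le' _ _ (X.fieldOn_mono' inter_subset_right) f

theorem proj_proj_of_subset (h : E ⊆ F) (f : Lp ℝ 2 P) : X.proj E (X.proj F f) = X.proj E f :=
  condProj_condProj_of_le' _ _ (X.fieldOn_mono' h) f

theorem proj_proj_of_subset' (h : E ⊆ F) (f : Lp ℝ 2 P) : X.proj F (X.proj E f) = X.proj E f :=
  condProj_condProj_of_le _ _ (X.fieldOn_mono' h) f

theorem norm_proj_mono (h : E ⊆ F) (f : Lp ℝ 2 P) : ‖X.proj E f‖ ≤ ‖X.proj F f‖ :=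
  norm_condProj_mono _ _ (X.fieldOn_mono' h) f

theorem proj_univ (f : Lp ℝ 2 P) : X.proj univ f = f :=
  (condProj_eq_self_iff _).2 <| (Lp.aestronglyMeasurable f).of_le_nullCompletion (X.fieldOn_le _)
    X.le_fieldOn_univ (integrable_of_L2 f)

theorem proj_closure (hE : IsTame E) (f : Lp ℝ 2 P) : X.proj (closure E) f = X.proj E f :=
  condProj_congr _ _ (X.fieldOn_closure_le hE) (X.fieldOn_mono' subset_closure) f

theorem norm_proj_sub_sq (h : E ⊆ F) (f : Lp ℝ 2 P) :
    ‖X.proj F f - X.proj E f‖ ^ 2 = ‖X.proj F f‖ ^ 2 - ‖X.proj E f‖ ^ 2 := by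
  have := norm_sub_condProj_sq (X.fieldOn_le E) (X.proj F f)
  change ‖X.proj F f - X.proj E (X.proj F f)‖ ^ 2 = _ - ‖X.proj E (X.proj F f)‖ ^ 2 at this
  rwa [X.proj_proj_of_subset h] at this

/-- The sets G n need not be nested, so the norm is squeezed between that of the increasing tail
intersections and that of E. -/
theorem tendsto_norm_proj {G : ℕ → Set ℝ} (hG : ∀ n, G n ⊆ E)
    (h : X.fieldOn E ≤ nullCompletion P (⨆ k, X.fieldOn (⋂ n, ⋂ (_ : k ≤ n), G n))) (f : Lp ℝ 2 P) :
    Tendsto (fun n => ‖X.proj (G n) f‖) atTop (𝓝 ‖X.proj E f‖) := by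
  have hsub : ∀ k, (⋂ n, ⋂ (_ : k ≤ n), G n) ⊆ G k := fun k => iInter₂_subset k le_rfl
  refine tendsto_of_tendsto_of_tendsto_of_le_of_le
    (tendsto_norm_condProj (fun k => X.fieldOn_le (⋂ n, ⋂ (_ : k ≤ n), G n)) (fun i j hij => ?_)
      (X.fieldOn_le E) (fun k => X.fieldOn_mono' ((hsub k).trans (hG k))) h f)
    tendsto_const_nhds (fun k => X.norm_proj_mono (hsub k) f) (fun k => X.norm_proj_mono (hG k) f)
  exact X.fieldOn_mono (subset_iInter₂ fun n hn => iInter₂_subset n (hij.trans hn))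

theorem fieldOn_le_iSup {U : Set ℝ} {G : ℕ → Set ℝ}
    (h : ∀ s t, Ioo s t ⊆ U → ∀ ε > 0, ∀ᶠ n in atTop, Ioo (s + ε) (t - ε) ⊆ G n) :
    X.fieldOn U ≤ nullCompletion P (⨆ k, X.fieldOn (⋂ n, ⋂ (_ : k ≤ n), G n)) := by
  have hle : ⨆ k, X.fieldOn (⋂ n, ⋂ (_ : k ≤ n), G n) ≤ m₀ := iSup_le fun k => X.fieldOn_le _
  refine X.fieldOn_le_of_shrink hle fun s t hst hU ε hε hε' => ?_
  obtain ⟨k, hk⟩ := eventually_atTop.1 (h s t hU ε hε)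
  refine ((X.field_le_fieldOn hε' ?_).trans
    (le_iSup (fun k => X.fieldOn (⋂ n, ⋂ (_ : k ≤ n), G n)) k)).trans (le_nullCompletion hle)
  exact subset_iInter₂ fun n hn => hk n hn

end ContinuousFactorization

/-! ### The events {M ⊆ E} and the Borel σ-field of the space of compact sets. -/

section CompactsIn

variable {E F : Set ℝ}

theorem compactsIn_inter : compactsIn (E ∩ F) = compactsIn E ∩ compactsIn F := by
  ext M
  exact subset_inter_iff

theorem compactsIn_mono (h : E ⊆ F) : compactsIn E ⊆ compactsIn F := fun _ hM => Subset.trans hM h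

theorem compactsIn_univ : compactsIn univ = univ := by
  ext M
  simp [compactsIn]

/-- This makes {M ⊆ E} Borel for tame E: a locally closed set is the intersection of its closure
with its open coborder. -/
theorem IsTame.isLocallyClosed (h : IsTame E) : IsLocallyClosed E := by
  refine ((isLocallyClosed_tfae E).out 0 3).2 fun x hx => ?_
  obtain ⟨u, hu, hu'⟩ : ∃ u, x < u ∧ (Ioo x u ⊆ E ∨ Disjoint (Ioo x u) E) :=
    ((h.exists_Ioo x).1.and self_mem_nhdsWithin).exists.imp fun _ h => ⟨h.2, h.1⟩
  obtain ⟨v, hv, hv'⟩ : ∃ v, v < x ∧ (Ioo v x ⊆ E ∨ Disjoint (Ioo v x) E) :=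
    ((h.exists_Ioo x).2.and self_mem_nhdsWithin).exists.imp fun _ h => ⟨h.2, h.1⟩
  refine ⟨Ioo v u, ⟨hv, hu⟩, isOpen_Ioo, fun y hy => ?_⟩
  rcases lt_trichotomy y x with hyx | rfl | hyx
  · exact hv'.resolve_right (fun h' => disjoint_left.1 (h'.closure_right isOpen_Ioo)
      ⟨hy.1.1, hyx⟩ hy.2) ⟨hy.1.1, hyx⟩
  · exact hx
  · exact hu'.resolve_right (fun h' => disjoint_left.1 (h'.closure_right isOpen_Ioo)
      ⟨hyx, hy.1.2⟩ hy.2) ⟨hyx, hy.1.2⟩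

theorem isOpen_compactsIn (h : IsOpen E) : IsOpen (compactsIn E) :=
  Compacts.isOpen_subsets_of_isOpen h

theorem isClosed_compactsIn (h : IsClosed E) : IsClosed (compactsIn E) :=
  Compacts.isClosed_subsets_of_isClosed h

theorem measurableSet_compactsIn (h : IsTame E) : MeasurableSet (compactsIn E) := by
  rw [← closure_inter_coborder (s := E), compactsIn_inter]
  exact (isClosed_compactsIn isClosed_closure).measurableSet.inter
    (isOpen_compactsIn h.isLocallyClosed.isOpen_coborder).measurableSet

theorem IsElementary.of_ordConnected (h : E.OrdConnected) : IsElementary E :=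
  ⟨{E}, finite_singleton _, by simpa using h, by simp⟩

theorem IsElementary.union (hE : IsElementary E) (hF : IsElementary F) : IsElementary (E ∪ F) := by
  obtain ⟨I, hI, hI', rfl⟩ := hE
  obtain ⟨J, hJ, hJ', rfl⟩ := hF
  exact ⟨I ∪ J, hI.union hJ, fun K hK => hK.elim (hI' K) (hJ' K), (sUnion_union I J).symm⟩

theorem IsElementary.inter (hE : IsElementary E) (hF : IsElementary F) : IsElementary (E ∩ F) := by
  obtain ⟨I, hI, hI', rfl⟩ := hE
  obtain ⟨J, hJ, hJ', rfl⟩ := hF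
  refine ⟨image2 (· ∩ ·) I J, hI.image2 _ hJ, ?_, ?_⟩
  · rintro _ ⟨K, hK, L, hL, rfl⟩
    exact (hI' K hK).inter (hJ' L hL)
  · ext x
    simp only [mem_inter_iff, mem_sUnion, mem_image2]
    constructor
    · rintro ⟨⟨K, hK, hx⟩, L, hL, hx'⟩
      exact ⟨_, ⟨K, hK, L, hL, rfl⟩, hx, hx'⟩
    · rintro ⟨_, ⟨K, hK, L, hL, rfl⟩, hx, hx'⟩
      exact ⟨⟨K, hK, hx⟩, L, hL, hx'⟩

theorem isElementary_univ : IsElementary univ := .of_ordConnected ordConnected_univ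

theorem isPiSystem_compactsIn : IsPiSystem (compactsIn '' {E | IsElementary E}) := by
  rintro _ ⟨E, hE, rfl⟩ _ ⟨F, hF, rfl⟩ -
  exact ⟨E ∩ F, IsElementary.inter hE hF, compactsIn_inter⟩

/-- Intervals with rational endpoints give a countable basis of the Vietoris topology, made of
conditions "M lies in a finite union" and "M meets U". The latter is the complement of {M ⊆ Uᶜ}, and
the complement of an open interval is again elementary. -/
theorem borel_compacts_eq :
    instMeasurableSpaceCompactsReal =
      MeasurableSpace.generateFrom (compactsIn '' {E | IsElementary E}) := by
  have hb := Real.isTopologicalBasis_Ioo_rat.compacts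
  refine le_antisymm ?_ (MeasurableSpace.generateFrom_le ?_)
  · change borel _ ≤ _
    rw [borel_eq_generateFrom_of_subbasis hb.eq_generateFrom]
    refine MeasurableSpace.generateFrom_le ?_
    rintro _ ⟨u, ⟨hu, hu'⟩, rfl⟩
    have hI : ∀ U ∈ u, ∃ a b : ℝ, U = Ioo a b := by
      intro U hU
      have := hu' hU
      simp only [mem_iUnion, mem_singleton_iff] at this
      obtain ⟨a, b, -, rfl⟩ := this
      exact ⟨a, b, rfl⟩
    have e : {K : Compacts ℝ | (K : Set ℝ) ⊆ ⋃₀ u ∧ ∀ U ∈ u, ((K : Set ℝ) ∩ U).Nonempty} =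
        compactsIn (⋃₀ u) ∩ ⋂ U ∈ u, (compactsIn Uᶜ)ᶜ := by
      ext K
      simp only [compactsIn, mem_inter_iff, mem_ofPred_eq, mem_iInter, mem_compl_iff,
        inter_compl_nonempty_iff.symm, compl_compl]
    simp only [e]
    refine MeasurableSet.inter ?_ (MeasurableSet.biInter hu.countable fun U hU => ?_)
    · have hu'' : IsElementary (⋃₀ u) := ⟨u, hu, fun U hU => by
        obtain ⟨a, b, rfl⟩ := hI U hU
        exact ordConnected_Ioo, rfl⟩
      exact MeasurableSpace.measurableSet_generateFrom ⟨_, hu'', rfl⟩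
    · suffices hU' : IsElementary Uᶜ from
        MeasurableSet.compl (MeasurableSpace.measurableSet_generateFrom
          (show compactsIn Uᶜ ∈ compactsIn '' {E | IsElementary E} from ⟨_, hU', rfl⟩))
      obtain ⟨a, b, rfl⟩ := hI U hU
      have : (Ioo a b)ᶜ = Iic a ∪ Ici b := by
        ext x
        simp only [mem_compl_iff, mem_Ioo, mem_union, mem_Iic, mem_Ici, not_and_or, not_lt]
      rw [this]
      exact IsElementary.union (.of_ordConnected ordConnected_Iic)
        (.of_ordConnected ordConnected_Ici)
  · rintro _ ⟨E, hE, rfl⟩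
    exact measurableSet_compactsIn (IsElementary.isTame hE)

theorem ext_of_compactsIn {μ ν : Measure (Compacts ℝ)} [IsFiniteMeasure μ]
    (h : ∀ E, IsElementary E → μ (compactsIn E) = ν (compactsIn E)) : μ = ν := by
  refine ext_of_generate_finite _ borel_compacts_eq isPiSystem_compactsIn ?_ ?_
  · rintro _ ⟨E, hE, rfl⟩
    exact h E hE
  · simpa [compactsIn_univ] using h univ isElementary_univ

end CompactsIn

/-! ### Contents as ultrafilter limits. -/

section Content

/-- A limit of finitely additive set functions along an ultrafilter is a content. -/
theorem exists_content_tendsto {G : Type*} [TopologicalSpace G] (Λ : ℕ → Set G → ℝ≥0) (C : ℝ≥0)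
    (hC : ∀ n K, Λ n K ≤ C) (hmono : ∀ n A B, A ⊆ B → Λ n A ≤ Λ n B)
    (hadd : ∀ n A B, Disjoint A B → Λ n (A ∪ B) = Λ n A + Λ n B)
    (hle : ∀ n A B, Λ n (A ∪ B) ≤ Λ n A + Λ n B) :
    ∃ μ : Content G, ∀ K : Compacts G,
      Tendsto (fun n => Λ n K) (hyperfilter ℕ) (𝓝 (μ.toFun K)) := by
  have hlim : ∀ K : Compacts G, ∃ l, Tendsto (fun n => Λ n K) (hyperfilter ℕ) (𝓝 l) := by
    intro K
    -- Every ultrafilter on the compact interval [0, C] converges, so all values converge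
    -- simultaneously and no diagonal extraction is needed.
    obtain ⟨l, -, hl⟩ := (isCompact_Icc (a := (0 : ℝ≥0)) (b := C)).ultrafilter_le_nhds
      ((hyperfilter ℕ).map fun n => Λ n K)
      (by
        rw [le_principal_iff, Ultrafilter.mem_coe, Ultrafilter.mem_map]
        exact Filter.univ_mem' fun n => ⟨zero_le, hC n K⟩)
    exact ⟨l, hl⟩
  choose l hl using hlim
  refine ⟨⟨l, fun K L h => ?_, fun K L h _ _ => ?_, fun K L => ?_⟩, hl⟩
  · exact le_of_tendsto_of_tendsto' (hl K) (hl L) fun n => hmono n _ _ h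
  · refine tendsto_nhds_unique (hl (K ⊔ L)) (((hl K).add (hl L)).congr fun n => ?_)
    rw [Compacts.coe_sup, hadd n _ _ h]
  · refine le_of_tendsto_of_tendsto' (hl (K ⊔ L)) ((hl K).add (hl L)) fun n => ?_
    rw [Compacts.coe_sup]
    exact hle n _ _

end Content

/-! ### Grids of the line and inner approximation by cells. -/

section Grid

/-- The half-open cells of a grid of step `1 / (n + 1)`. -/
noncomputable def cell (n : ℕ) (k : ℤ) : Set ℝ := {x | ⌊((n : ℝ) + 1) * x⌋ = k}

/-- The closed cells of a grid of step `1 / (n + 1)`. -/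
noncomputable def closedCell (n : ℕ) (k : ℤ) : Set ℝ := Icc ((k : ℝ) / (n + 1)) ((k + 1) / (n + 1))

/-- The indices of the cells that are contained in `[-(n+1), n+1]`. -/
noncomputable def cellIndices (n : ℕ) : Finset ℤ := Finset.Ico (-((n : ℤ) + 1) ^ 2) (((n : ℤ) + 1) ^ 2)

theorem mem_cell {n : ℕ} {k : ℤ} {x : ℝ} :
    x ∈ cell n k ↔ (k : ℝ) ≤ (n + 1) * x ∧ (n + 1) * x < k + 1 := Int.floor_eq_iff

theorem cell_subset_closedCell (n : ℕ) (k : ℤ) : cell n k ⊆ closedCell n k := fun x hx => by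
  obtain ⟨h1, h2⟩ := mem_cell.1 hx
  have hn : (0 : ℝ) < n + 1 := by positivity
  exact ⟨by rw [div_le_iff₀ hn]; linarith, by rw [le_div_iff₀ hn]; linarith⟩

theorem isTame_cell (n : ℕ) (k : ℤ) : IsTame (cell n k) := by
  refine .of_ordConnected ⟨fun x hx y hy z hz => ?_⟩
  rw [mem_cell] at hx hy ⊢
  have hn : (0 : ℝ) < n + 1 := by positivity
  exact ⟨hx.1.trans (by nlinarith [hz.1]), lt_of_le_of_lt (by nlinarith [hz.2]) hy.2⟩

theorem disjoint_cell (n : ℕ) : Pairwise (Function.onFun Disjoint (cell n)) := fun _ _ hij =>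
  disjoint_left.2 fun _ hx hx' => hij (hx.symm.trans hx')

theorem abs_sub_lt_of_mem_cell {n : ℕ} {k : ℤ} {x y : ℝ} (hx : x ∈ cell n k) (hy : y ∈ cell n k) :
    |x - y| < 1 / (n + 1) := by
  rw [mem_cell] at hx hy
  have hn : (0 : ℝ) < n + 1 := by positivity
  rw [lt_div_iff₀ hn]
  calc |x - y| * ((n : ℝ) + 1) = |(n + 1) * x - (n + 1) * y| := by
        rw [← mul_sub, abs_mul, abs_of_pos hn, mul_comm]
    _ < 1 := by rw [abs_lt]; constructor <;> linarith

theorem mem_cellIndices {n : ℕ} {k : ℤ} {x : ℝ} (hx : x ∈ cell n k) (h1 : -((n : ℝ) + 1) ≤ x)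
    (h2 : x < n + 1) : k ∈ cellIndices n := by
  rw [mem_cell] at hx
  have hn : (0 : ℝ) < n + 1 := by positivity
  rw [cellIndices, Finset.mem_Ico]
  constructor
  · rw [← Int.lt_add_one_iff]
    have : (-((n : ℝ) + 1) ^ 2) < k + 1 := lt_of_le_of_lt (by nlinarith) hx.2
    exact_mod_cast this
  · have : (k : ℝ) < ((n : ℝ) + 1) ^ 2 := lt_of_le_of_lt hx.1 (by nlinarith)
    exact_mod_cast this

open Classical in
/-- The indices of the closed cells inside a given set. -/
noncomputable def cellsIn (n : ℕ) (U : Set ℝ) : Finset ℤ :=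
  (cellIndices n).filter fun k => closedCell n k ⊆ U

/-- The union of the half-open cells whose closures are inside a given set. -/
noncomputable def gridIn (n : ℕ) (U : Set ℝ) : Set ℝ := ⋃ k ∈ cellsIn n U, cell n k

/-- A finite union of closed cells. -/
noncomputable def cellUnion (n : ℕ) (S : Finset ℤ) : Compacts ℝ :=
  ⟨⋃ k ∈ S, closedCell n k, S.isCompact_biUnion fun _ _ => isCompact_Icc⟩

theorem coe_cellUnion (n : ℕ) (S : Finset ℤ) :
    (cellUnion n S : Set ℝ) = ⋃ k ∈ S, closedCell n k := rfl

theorem mem_cellsIn {n : ℕ} {U : Set ℝ} {k : ℤ} :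
    k ∈ cellsIn n U ↔ k ∈ cellIndices n ∧ closedCell n k ⊆ U := by
  classical
  simp [cellsIn]

theorem cellUnion_cellsIn_subset (n : ℕ) (U : Set ℝ) : (cellUnion n (cellsIn n U) : Set ℝ) ⊆ U :=
  iUnion₂_subset fun _ hk => (mem_cellsIn.1 hk).2

theorem gridIn_subset_cellUnion (n : ℕ) (U : Set ℝ) :
    gridIn n U ⊆ (cellUnion n (cellsIn n U) : Set ℝ) :=
  iUnion₂_mono fun _ _ => cell_subset_closedCell _ _

theorem gridIn_subset (n : ℕ) (U : Set ℝ) : gridIn n U ⊆ U :=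
  (gridIn_subset_cellUnion n U).trans (cellUnion_cellsIn_subset n U)

theorem isTame_gridIn (n : ℕ) (U : Set ℝ) : IsTame (gridIn n U) :=
  .biUnion _ fun _ _ => isTame_cell _ _

theorem isTame_cellUnion (n : ℕ) (S : Finset ℤ) : IsTame (cellUnion n S : Set ℝ) :=
  .biUnion _ fun _ _ => .of_ordConnected ordConnected_Icc

theorem eventually_Ioo_subset_gridIn {U : Set ℝ} {s t : ℝ} (h : Ioo s t ⊆ U) {ε : ℝ} (hε : 0 < ε) :
    ∀ᶠ n in atTop, Ioo (s + ε) (t - ε) ⊆ gridIn n U := by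
  -- Two conditions on n: the step is below ε, so that the closed cell of a point stays within (s,
  -- t), and the window [-(n+1), n+1) covers (s, t).
  filter_upwards [(tendsto_one_div_add_atTop_nhds_zero_nat (𝕜 := ℝ)).eventually (gt_mem_nhds hε),
    eventually_ge_atTop ⌈max (-s) t⌉₊] with n hn hn' x hx
  have hn'' : max (-s) t ≤ n := (Nat.le_ceil _).trans (by exact_mod_cast hn')
  have hn1 : -s ≤ n := (le_max_left _ _).trans hn''
  have hn2 : t ≤ n := (le_max_right _ _).trans hn''
  have hn0 : (0 : ℝ) < n + 1 := by positivity
  have hxc : x ∈ cell n ⌊((n : ℝ) + 1) * x⌋ := rfl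
  refine mem_iUnion₂.2 ⟨⌊((n : ℝ) + 1) * x⌋, mem_cellsIn.2 ⟨mem_cellIndices hxc ?_ ?_,
    fun y hy => h ?_⟩, hxc⟩
  · linarith [hx.1]
  · linarith [hx.2]
  · obtain ⟨h1, h2⟩ := cell_subset_closedCell _ _ hxc
    obtain ⟨h3, h4⟩ := hy
    rw [add_div] at h2 h4
    constructor
    · linarith [hx.1]
    · linarith [hx.2]

end Grid

/-! ### Existence and uniqueness of the spectral measure. -/

namespace ContinuousFactorization

variable {Ω : Type*} {m₀ : MeasurableSpace Ω} {P : Measure Ω} [IsProbabilityMeasure P]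
  (X : ContinuousFactorization P)

/-- The weight of S is the spectral mass of the event that, among the cells, exactly those in S are
hit; the point is that these inclusion-exclusion differences are nonnegative. Induct on the cells:
sets S without a use f, sets with a use the part of f orthogonal to L₂ of the complement of D a. The
base set B, always allowed, is what lets D a be absorbed in the second case. -/
theorem exists_weights {ι : Type*} [DecidableEq ι] {D : ι → Set ℝ} (s : Finset ι)
    (hD : ∀ i ∈ s, IsTame (D i)) (hdisj : Pairwise (Function.onFun Disjoint D)) :
    ∀ B : Set ℝ, IsTame B → (∀ i ∈ s, Disjoint B (D i)) → ∀ f : Lp ℝ 2 P,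
      ∃ w : Finset ι → ℝ≥0, ∀ T ⊆ s,
        ((∑ S ∈ T.powerset, w S : ℝ≥0) : ℝ) = ‖X.proj (B ∪ ⋃ i ∈ T, D i) f‖ ^ 2 := by
  induction s using Finset.induction_on with
  | empty =>
    intro B hB _ f
    refine ⟨fun _ => ‖X.proj B f‖₊ ^ 2, fun T hT => ?_⟩
    rw [Finset.subset_empty.1 hT]
    simp
  | insert a s ha ih =>
    intro B hB hBD f
    have hs : ∀ i ∈ s, IsTame (D i) := fun i hi => hD i (by simp [hi])
    have hDa : IsTame (D a) := hD a (by simp)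
    have has : ∀ i ∈ s, Disjoint (D a) (D i) := fun i hi => hdisj (by rintro rfl; exact ha hi)
    obtain ⟨w₀, hw₀⟩ := ih hs B hB (fun i hi => hBD i (by simp [hi])) f
    obtain ⟨w₁, hw₁⟩ := ih hs (B ∪ D a) (hB.union hDa)
      (fun i hi => disjoint_union_left.2 ⟨hBD i (by simp [hi]), has i hi⟩) (f - X.proj (D a)ᶜ f)
    refine ⟨fun S => if a ∈ S then w₁ (S.erase a) else w₀ S, fun T hT => ?_⟩
    by_cases haT : a ∈ T
    · obtain ⟨T', haT', rfl⟩ : ∃ T', a ∉ T' ∧ insert a T' = T :=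
        ⟨T.erase a, Finset.notMem_erase a T, Finset.insert_erase haT⟩
      have hT's : T' ⊆ s := fun i hi => by
        rcases Finset.mem_insert.1 (hT (Finset.mem_insert_of_mem hi)) with rfl | h
        · exact (haT' hi).elim
        · exact h
      rw [Finset.sum_powerset_insert haT', NNReal.coe_add]
      have h0 : ∑ S ∈ T'.powerset, (if a ∈ S then w₁ (S.erase a) else w₀ S) =
          ∑ S ∈ T'.powerset, w₀ S := Finset.sum_congr rfl fun S hS =>
        if_neg fun h => haT' (Finset.mem_powerset.1 hS h)
      have h1 : ∑ S ∈ T'.powerset, (if a ∈ insert a S then w₁ ((insert a S).erase a)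
          else w₀ (insert a S)) = ∑ S ∈ T'.powerset, w₁ S := Finset.sum_congr rfl fun S hS => by
        rw [if_pos (Finset.mem_insert_self a S),
          Finset.erase_insert fun h => haT' (Finset.mem_powerset.1 hS h)]
      have hT'tame : IsTame (⋃ i ∈ T', D i) := .biUnion _ fun i hi => hs i (hT's hi)
      have hG : (B ∪ D a ∪ ⋃ i ∈ T', D i) ∩ (D a)ᶜ = B ∪ ⋃ i ∈ T', D i := by
        have hd1 : Disjoint B (D a) := hBD a (by simp)
        have hd2 : Disjoint (⋃ i ∈ T', D i) (D a) :=
          disjoint_iUnion₂_left.2 fun i hi => (has i (hT's hi)).symm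
        rw [← sdiff_eq, union_right_comm, union_sdiff_right, (hd1.union_left hd2).sdiff_eq_left]
      rw [h0, h1, hw₀ T' hT's, hw₁ T' hT's, map_sub,
        X.proj_proj ((hB.union hDa).union hT'tame) hDa.compl, hG,
        X.norm_proj_sub_sq (union_subset_union_left _ subset_union_left),
        Finset.set_biUnion_insert, union_assoc]
      ring
    · have hTs : T ⊆ s := fun i hi => by
        rcases Finset.mem_insert.1 (hT hi) with rfl | h
        · exact (haT hi).elim
        · exact h
      rw [← hw₀ T hTs]
      congr 1
      exact Finset.sum_congr rfl fun S hS => if_neg fun h => haT (Finset.mem_powerset.1 hS h)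

theorem tendsto_norm_proj_gridIn (U : Set ℝ) (f : Lp ℝ 2 P) :
    Tendsto (fun n => ‖X.proj (gridIn n U) f‖) atTop (𝓝 ‖X.proj U f‖) :=
  X.tendsto_norm_proj (fun n => gridIn_subset n U)
    (X.fieldOn_le_iSup fun _ _ h _ hε => eventually_Ioo_subset_gridIn h hε) f

/-- Continuity from above on closed sets. -/
theorem tendsto_norm_proj_compl_cellUnion {C : Set ℝ} (hC : IsTame C) (f : Lp ℝ 2 P) :
    Tendsto (fun n => ‖X.proj (cellUnion n (cellsIn n Cᶜ) : Set ℝ)ᶜ f‖) atTop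
      (𝓝 ‖X.proj C f‖) := by
  -- The sets C ∪ `gridIn n Cᶜ` exhaust the whole σ-field. The complement of the closed cells meets
  -- such a set exactly in C, so the error in question is a projection of f - `X.proj (C ∪ gridIn n
  -- Cᶜ) f`, which tends to zero.
  have h1 : Tendsto (fun n => ‖X.proj (C ∪ gridIn n Cᶜ) f‖) atTop (𝓝 ‖X.proj univ f‖) := by
    refine X.tendsto_norm_proj (fun n => subset_univ _) ?_ f
    have hle : ⨆ k, X.fieldOn (⋂ n, ⋂ (_ : k ≤ n), (C ∪ gridIn n Cᶜ)) ≤ m₀ :=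
      iSup_le fun k => X.fieldOn_le _
    have := X.fieldOn_union_le hC hC.compl
    rw [union_compl_self] at this
    refine this.trans (nullCompletion_le_of_le (sup_le ?_ ?_))
    · refine le_trans ?_ (le_nullCompletion hle)
      exact le_iSup_of_le 0 (X.fieldOn_mono (subset_iInter₂ fun n _ => subset_union_left))
    · refine (X.fieldOn_le_iSup (G := fun n => gridIn n Cᶜ)
        fun _ _ h _ hε => eventually_Ioo_subset_gridIn h hε).trans (nullCompletion_mono hle ?_)
      exact iSup_mono fun k => X.fieldOn_mono (iInter₂_mono fun n _ => subset_union_right)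
  rw [proj_univ] at h1
  have h2 : Tendsto (fun n => ‖f - X.proj (C ∪ gridIn n Cᶜ) f‖) atTop (𝓝 0) := by
    have : Tendsto (fun n => √(‖f‖ ^ 2 - ‖X.proj (C ∪ gridIn n Cᶜ) f‖ ^ 2)) atTop
        (𝓝 (√(‖f‖ ^ 2 - ‖f‖ ^ 2))) := (tendsto_const_nhds.sub (h1.pow 2)).sqrt
    rw [sub_self, Real.sqrt_zero] at this
    refine this.congr fun n => ?_
    have := norm_sub_condProj_sq (X.fieldOn_le (C ∪ gridIn n Cᶜ)) f
    change ‖f - X.proj (C ∪ gridIn n Cᶜ) f‖ ^ 2 = _ - ‖X.proj (C ∪ gridIn n Cᶜ) f‖ ^ 2 at this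
    rw [← this, Real.sqrt_sq (norm_nonneg _)]
  have h3 : ∀ n, ‖X.proj (cellUnion n (cellsIn n Cᶜ) : Set ℝ)ᶜ f - X.proj C f‖ ≤
      ‖f - X.proj (C ∪ gridIn n Cᶜ) f‖ := fun n => by
    have e : (cellUnion n (cellsIn n Cᶜ) : Set ℝ)ᶜ ∩ (C ∪ gridIn n Cᶜ) = C := by
      have h' := cellUnion_cellsIn_subset n Cᶜ
      have h'' := gridIn_subset_cellUnion n Cᶜ
      ext x
      constructor
      · rintro ⟨hx, hx' | hx'⟩
        · exact hx'
        · exact (hx (h'' hx')).elim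
      · exact fun hx => ⟨fun hx' => h' hx' hx, Or.inl hx⟩
    have := X.proj_proj (isTame_cellUnion n (cellsIn n Cᶜ)).compl
      (hC.union (isTame_gridIn n Cᶜ)) f
    rw [e] at this
    rw [← this, ← map_sub]
    exact X.norm_proj_le _
  rw [tendsto_iff_norm_sub_tendsto_zero]
  refine squeeze_zero (fun n => norm_nonneg _) (fun n => ?_) h2
  exact (abs_norm_sub_norm_le _ _).trans (h3 n)

-- The approximants are purely atomic: the weight of S sits at the union of the closed cells in S.
-- This union lies in U exactly when each of its cells does, which yields the last identity.
open Classical in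
theorem exists_masses (f : Lp ℝ 2 P) :
    ∃ Λ : ℕ → Set (Compacts ℝ) → ℝ≥0, (∀ n A B, A ⊆ B → Λ n A ≤ Λ n B) ∧
      (∀ n A B, Disjoint A B → Λ n (A ∪ B) = Λ n A + Λ n B) ∧
      (∀ n A B, Λ n (A ∪ B) ≤ Λ n A + Λ n B) ∧
      ∀ n U, (Λ n (compactsIn U) : ℝ) = ‖X.proj (gridIn n U) f‖ ^ 2 := by
  choose w hw using fun n => X.exists_weights (cellIndices n) (fun i _ => isTame_cell n i)
    (disjoint_cell n) ∅ .empty (by simp) f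
  refine ⟨fun n A => ∑ S ∈ (cellIndices n).powerset, if cellUnion n S ∈ A then w n S else 0,
    fun n A B h => Finset.sum_le_sum fun S _ => ?_, fun n A B h => ?_, fun n A B => ?_,
    fun n U => ?_⟩
  · by_cases hS : cellUnion n S ∈ A
    · simp [hS, h hS]
    · simp [hS]
  · rw [← Finset.sum_add_distrib]
    refine Finset.sum_congr rfl fun S _ => ?_
    by_cases hS : cellUnion n S ∈ A
    · simp [hS, disjoint_left.1 h hS]
    · simp [hS]
  · rw [← Finset.sum_add_distrib]
    refine Finset.sum_le_sum fun S _ => ?_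
    by_cases hS : cellUnion n S ∈ A <;> by_cases hS' : cellUnion n S ∈ B <;> simp [hS, hS']
  · have h := hw n (cellsIn n U) (fun k hk => (mem_cellsIn.1 hk).1)
    rw [empty_union] at h
    rw [gridIn, ← h]
    simp only []
    rw [← Finset.sum_filter]
    congr 2
    ext S
    simp only [Finset.mem_filter, Finset.mem_powerset, compactsIn, mem_ofPred_eq, coe_cellUnion,
      iUnion₂_subset_iff]
    constructor
    · rintro ⟨h1, h2⟩ k hk
      exact mem_cellsIn.2 ⟨h1 hk, h2 k hk⟩
    · exact fun h => ⟨fun k hk => (mem_cellsIn.1 (h hk)).1,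
        fun k hk => (mem_cellsIn.1 (h hk)).2⟩

/-- The spectral measure exists, and satisfies its defining relation for all tame sets. -/
theorem exists_measure_compactsIn (f : Lp ℝ 2 P) :
    ∃ μ : Measure (Compacts ℝ), ∀ E : Set ℝ, IsTame E →
      μ (compactsIn E) = ENNReal.ofReal (‖X.proj E f‖ ^ 2) := by
  obtain ⟨Λ, hmono, hadd, hle, hΛ⟩ := X.exists_masses f
  have hbd : ∀ n U, Λ n (compactsIn U) ≤ ‖X.proj U f‖₊ ^ 2 := fun n U => by
    rw [← NNReal.coe_le_coe, hΛ]
    push_cast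
    gcongr
    exact X.norm_proj_mono (gridIn_subset n U) f
  obtain ⟨ν, hν⟩ := exists_content_tendsto Λ (‖f‖₊ ^ 2) (fun n K => by
    refine (hmono n _ _ (subset_univ K)).trans ?_
    have := hbd n univ
    rwa [compactsIn_univ, proj_univ] at this) hmono hadd hle
  -- The event {M ⊆ V} is open, so its measure is the supremum of the content over compact families
  -- inside it.
  have hopen : ∀ V : Set ℝ, IsOpen V →
      ν.measure (compactsIn V) ≤ ENNReal.ofReal (‖X.proj V f‖ ^ 2) := by
    intro V hV
    rw [ν.measure_apply (isOpen_compactsIn hV).measurableSet,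
      ν.outerMeasure_of_isOpen _ (isOpen_compactsIn hV)]
    refine iSup₂_le fun K hK => ?_
    have h1 : ν.toFun K ≤ ‖X.proj V f‖₊ ^ 2 :=
      le_of_tendsto' (hν K) fun n => (hmono n _ _ hK).trans (hbd n V)
    change (ν.toFun K : ℝ≥0∞) ≤ _
    rw [ENNReal.ofReal, ENNReal.coe_le_coe]
    refine h1.trans (NNReal.le_toNNReal_of_coe_le ?_)
    push_cast
    exact le_rfl
  -- The set is approximated from outside by the open complements of finite unions of closed cells.
  have hclosed : ∀ C : Set ℝ, IsTame C →
      ν.measure (compactsIn C) ≤ ENNReal.ofReal (‖X.proj C f‖ ^ 2) := by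
    intro C hC
    refine ge_of_tendsto' (ENNReal.tendsto_ofReal ((X.tendsto_norm_proj_compl_cellUnion hC f).pow 2))
      fun n => le_trans (measure_mono (compactsIn_mono ?_))
        (hopen _ (cellUnion n (cellsIn n Cᶜ)).isCompact.isClosed.isOpen_compl)
    exact subset_compl_comm.1 (cellUnion_cellsIn_subset n Cᶜ)
  -- For compact C the event {M ⊆ C} is itself compact, so its content, a limit of grid masses,
  -- bounds the measure from below. The lower bound for tame E then follows from compact cell unions
  -- inside E.
  have hcompact : ∀ C : Set ℝ, IsCompact C →
      ENNReal.ofReal (‖X.proj C f‖ ^ 2) ≤ ν.measure (compactsIn C) := by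
    intro C hC
    let K : Compacts (Compacts ℝ) := ⟨compactsIn C, Compacts.isCompact_subsets_of_isCompact hC⟩
    rw [ν.measure_apply (isClosed_compactsIn hC.isClosed).measurableSet]
    refine le_trans (le_of_eq ?_) (ν.le_outerMeasure_compacts K)
    change _ = (ν.toFun K : ℝ≥0∞)
    have h1 : Tendsto (fun n => (Λ n K : ℝ)) (hyperfilter ℕ) (𝓝 (ν.toFun K)) :=
      (NNReal.continuous_coe.tendsto _).comp (hν K)
    have h2 : Tendsto (fun n => (Λ n K : ℝ)) (hyperfilter ℕ) (𝓝 (‖X.proj C f‖ ^ 2)) := by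
      refine (((X.tendsto_norm_proj_gridIn C f).pow 2).mono_left Nat.hyperfilter_le_atTop).congr
        fun n => (hΛ n C).symm
    rw [← tendsto_nhds_unique h1 h2, ENNReal.ofReal_coe_nnreal]
  refine ⟨ν.measure, fun E hE => le_antisymm (hclosed E hE) ?_⟩
  refine le_of_tendsto' (ENNReal.tendsto_ofReal ((X.tendsto_norm_proj_gridIn E f).pow 2))
    fun n => ?_
  refine le_trans ?_ ((hcompact _ (cellUnion n (cellsIn n E)).isCompact).trans
    (measure_mono (compactsIn_mono (cellUnion_cellsIn_subset n E))))
  gcongr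
  exact X.norm_proj_mono (gridIn_subset_cellUnion n E) f

theorem isSpectralMeasure_iff {f : Lp ℝ 2 P} {μ : Measure (Compacts ℝ)} :
    X.IsSpectralMeasure f μ ↔
      ∀ E, IsElementary E → μ (compactsIn E) = ENNReal.ofReal (‖X.proj E f‖ ^ 2) := by
  refine forall₂_congr fun E _ => ?_
  rw [eLpNorm_condExp_sq (X.fieldOn_le E)]
  rfl

/-- The spectral measure. -/
noncomputable def spec (f : Lp ℝ 2 P) : Measure (Compacts ℝ) :=
  (X.exists_measure_compactsIn f).choose

theorem spec_compactsIn (f : Lp ℝ 2 P) {E : Set ℝ} (hE : IsTame E) :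
    X.spec f (compactsIn E) = ENNReal.ofReal (‖X.proj E f‖ ^ 2) :=
  (X.exists_measure_compactsIn f).choose_spec E hE

theorem spec_univ (f : Lp ℝ 2 P) : X.spec f univ = ENNReal.ofReal (‖f‖ ^ 2) := by
  rw [← compactsIn_univ, X.spec_compactsIn f .univ, proj_univ]

instance (f : Lp ℝ 2 P) : IsFiniteMeasure (X.spec f) := ⟨by
  rw [spec_univ]; exact ENNReal.ofReal_lt_top⟩

theorem isSpectralMeasure_spec (f : Lp ℝ 2 P) : X.IsSpectralMeasure f (X.spec f) :=
  X.isSpectralMeasure_iff.2 fun _ hE => X.spec_compactsIn f hE.isTame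

theorem eq_spec {f : Lp ℝ 2 P} {μ : Measure (Compacts ℝ)}
    (h : ∀ E, IsElementary E → μ (compactsIn E) = ENNReal.ofReal (‖X.proj E f‖ ^ 2)) :
    μ = X.spec f :=
  (ext_of_compactsIn fun E hE => (X.spec_compactsIn f hE.isTame).trans (h E hE).symm).symm

theorem existsUnique_isSpectralMeasure (f : Lp ℝ 2 P) :
    ∃! μ : Measure (Compacts ℝ), X.IsSpectralMeasure f μ :=
  ⟨X.spec f, X.isSpectralMeasure_spec f, fun _ h => X.eq_spec (X.isSpectralMeasure_iff.1 h)⟩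

theorem mem_spectralSubspace {f : Lp ℝ 2 P} {𝓜 : Set (Compacts ℝ)} :
    f ∈ X.spectralSubspace 𝓜 ↔ X.spec f 𝓜ᶜ = 0 :=
  ⟨fun ⟨_, h, h'⟩ => X.eq_spec (X.isSpectralMeasure_iff.1 h) ▸ h',
    fun h => ⟨_, X.isSpectralMeasure_spec f, h⟩⟩

end ContinuousFactorization

/-! ### Closed sublattices of L₂ come from sub-σ-fields. -/

section Lattice

variable {Ω : Type*} {m₀ : MeasurableSpace Ω} {P : Measure Ω}

theorem mem_of_forall_inner_eq_zero {H : Submodule ℝ (Lp ℝ 2 P)} (hc : IsClosed (H : Set (Lp ℝ 2 P)))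
    {f : Lp ℝ 2 P} (h : ∀ g, (∀ u ∈ H, ⟪u, g⟫_ℝ = 0) → ⟪f, g⟫_ℝ = 0) : f ∈ H := by
  have : CompleteSpace H := hc.completeSpace_coe
  rw [← H.orthogonal_orthogonal, Submodule.mem_orthogonal']
  exact fun g hg => h g fun u hu => (Submodule.mem_orthogonal _ _).1 hg u hu

variable [IsProbabilityMeasure P]

/-- Weak convergence suffices for a closed subspace, and dominated convergence against each fixed g
supplies it. -/
theorem mem_of_tendsto_ae {H : Submodule ℝ (Lp ℝ 2 P)} (hc : IsClosed (H : Set (Lp ℝ 2 P)))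
    {u : ℕ → Lp ℝ 2 P} {f : Lp ℝ 2 P} (hu : ∀ n, u n ∈ H) (hbd : ∀ n, ∀ᵐ ω ∂P, |u n ω| ≤ 1)
    (hlim : ∀ᵐ ω ∂P, Tendsto (fun n => u n ω) atTop (𝓝 (f ω))) : f ∈ H := by
  refine mem_of_forall_inner_eq_zero hc fun g hg => ?_
  have hzero : ∀ n, ∫ ω, u n ω * g ω ∂P = 0 := fun n => by
    rw [← inner_eq_integral]
    exact hg _ (hu n)
  have h := tendsto_integral_of_dominated_convergence (μ := P) (F := fun n ω => u n ω * g ω)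
    (f := fun ω => f ω * g ω) (fun ω => |g ω|)
    (fun n => (Lp.aestronglyMeasurable _).mul (Lp.aestronglyMeasurable _))
    (integrable_of_L2 g).abs (fun n => ?_) ?_
  · simp only [hzero] at h
    rw [inner_eq_integral]
    exact (tendsto_nhds_unique h tendsto_const_nhds)
  · filter_upwards [hbd n] with ω hω
    rw [Real.norm_eq_abs, abs_mul]
    exact mul_le_of_le_one_left (abs_nonneg _) hω
  · filter_upwards [hlim] with ω hω using hω.mul_const _

/-- A closed subspace of `L₂` that contains the constants, and the absolute values of its elements,
consists of the square integrable functions measurable with respect to some sub-σ-field. -/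
theorem exists_measurableSpace_of_abs_mem (H : Submodule ℝ (Lp ℝ 2 P))
    (hc : IsClosed (H : Set (Lp ℝ 2 P))) (h1 : Lp.const 2 P (1 : ℝ) ∈ H)
    (habs : ∀ f ∈ H, |f| ∈ H) :
    ∃ G : MeasurableSpace Ω, G ≤ m₀ ∧ ∀ f : Lp ℝ 2 P, f ∈ H ↔ AEStronglyMeasurable[G] f P := by
  have hsup : ∀ f ∈ H, ∀ g ∈ H, f ⊔ g ∈ H := fun f hf g hg => by
    rw [sup_eq_half_smul_add_add_abs_sub' ℝ]
    exact H.smul_mem _ (H.add_mem (H.add_mem hf hg) (habs _ (H.sub_mem hg hf)))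
  have hinf : ∀ f ∈ H, ∀ g ∈ H, f ⊓ g ∈ H := fun f hf g hg => by
    rw [inf_eq_half_smul_add_sub_abs_sub' ℝ]
    exact H.smul_mem _ (H.sub_mem (H.add_mem hf hg) (habs _ (H.sub_mem hg hf)))
  have hone : (Lp.const 2 P (1 : ℝ) : Ω → ℝ) =ᵐ[P] fun _ => 1 := Lp.coeFn_const 2 P (1 : ℝ)
  let S : Set Ω → Prop := fun A => MeasurableSet A ∧ ∃ g ∈ H, g =ᵐ[P] A.indicator fun _ => (1 : ℝ)
  have hbd : ∀ (A : Set Ω) (g : Ω → ℝ), g =ᵐ[P] (A.indicator fun _ => (1 : ℝ)) →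
      ∀ᵐ ω ∂P, |g ω| ≤ 1 := by
    intro A g hg
    filter_upwards [hg] with ω hω
    rw [hω]
    by_cases h : ω ∈ A <;> simp [h]
  have hSempty : S ∅ := ⟨.empty, 0, H.zero_mem, by
    rw [indicator_empty]; exact Lp.coeFn_zero ℝ 2 P⟩
  have hSunion : ∀ A B, S A → S B → S (A ∪ B) := by
    rintro A B ⟨hA, f, hf, hfA⟩ ⟨hB, g, hg, hgB⟩
    refine ⟨hA.union hB, f ⊔ g, hsup f hf g hg, ?_⟩
    filter_upwards [Lp.coeFn_sup f g, hfA, hgB] with ω h1 h2 h3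
    rw [h1, Pi.sup_apply, h2, h3]
    by_cases hA' : ω ∈ A <;> by_cases hB' : ω ∈ B <;> simp [hA', hB']
  have hScompl : ∀ A, S A → S Aᶜ := by
    rintro A ⟨hA, f, hf, hfA⟩
    refine ⟨hA.compl, Lp.const 2 P (1 : ℝ) - f, H.sub_mem h1 hf, ?_⟩
    filter_upwards [Lp.coeFn_sub (Lp.const 2 P (1 : ℝ)) f, hfA, hone] with ω h1 h2 h3
    rw [h1, Pi.sub_apply, h2, h3]
    by_cases hA' : ω ∈ A <;> simp [hA']
  have hSlim : ∀ (A : Set Ω) (u : ℕ → Lp ℝ 2 P), MeasurableSet A → (∀ n, u n ∈ H) →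
      (∀ n, ∀ᵐ ω ∂P, |u n ω| ≤ 1) →
      (∀ᵐ ω ∂P, Tendsto (fun n => u n ω) atTop (𝓝 (A.indicator (fun _ => (1 : ℝ)) ω))) → S A := by
    intro A u hA hu hub hul
    have hI := indicatorConstLp_coeFn (p := 2) (hs := hA) (hμs := measure_ne_top P A) (c := (1 : ℝ))
    refine ⟨hA, _, mem_of_tendsto_ae hc hu hub ?_, hI⟩
    filter_upwards [hul, hI] with ω h1 h2
    rwa [h2]
  have hSiUnion : ∀ A : ℕ → Set Ω, (∀ n, S (A n)) → S (⋃ n, A n) := by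
    intro A hA
    have hacc : ∀ n, S (accumulate A n) := by
      intro n
      induction n with
      | zero => rw [accumulate_zero_nat]; exact hA 0
      | succ n ih => rw [accumulate_succ]; exact hSunion _ _ ih (hA _)
    choose u hu hu' using fun n => (hacc n).2
    refine hSlim _ u (.iUnion fun n => (hA n).1) hu (fun n => hbd _ _ (hu' n)) ?_
    filter_upwards [ae_all_iff.2 hu'] with ω hω
    simp only [hω]
    rw [← iUnion_accumulate]
    exact (monotone_accumulate.tendsto_indicator _ _ _).mono_right (pure_le_nhds _)
  let G : MeasurableSpace Ω :=
    { MeasurableSet' := S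
      measurableSet_empty := hSempty
      measurableSet_compl := hScompl
      measurableSet_iUnion := hSiUnion }
  have hG : G ≤ m₀ := fun A hA => hA.1
  refine ⟨G, hG, fun f => ⟨fun hf => ?_, fun hf => ?_⟩⟩
  · refine StronglyMeasurable.aestronglyMeasurable (Measurable.stronglyMeasurable ?_)
    refine @measurable_of_Ioi _ _ _ _ _ G _ _ _ _ fun c => ?_
    -- The truncations min(max(n(f - c), 0), 1) stay in the lattice and converge to the indicator of
    -- {f > c}.
    let u : ℕ → Lp ℝ 2 P := fun n =>
      (((n : ℝ) • (f - c • Lp.const 2 P (1 : ℝ))) ⊔ 0) ⊓ Lp.const 2 P (1 : ℝ)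
    have huH : ∀ n, u n ∈ H := fun n => hinf _ (hsup _ (H.smul_mem _ (H.sub_mem hf
      (H.smul_mem _ h1))) _ H.zero_mem) _ h1
    have hu : ∀ n, ∀ᵐ ω ∂P, u n ω = min (max (n * (f ω - c)) 0) 1 := by
      intro n
      filter_upwards [Lp.coeFn_inf (((n : ℝ) • (f - c • Lp.const 2 P (1 : ℝ))) ⊔ 0)
        (Lp.const 2 P (1 : ℝ)), Lp.coeFn_sup ((n : ℝ) • (f - c • Lp.const 2 P (1 : ℝ))) 0,
        Lp.coeFn_smul (n : ℝ) (f - c • Lp.const 2 P (1 : ℝ)),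
        Lp.coeFn_sub f (c • Lp.const 2 P (1 : ℝ)), Lp.coeFn_smul c (Lp.const 2 P (1 : ℝ)),
        hone, Lp.coeFn_zero ℝ 2 P] with ω e1 e2 e3 e4 e5 e6 e7
      simp only [u]
      rw [e1, Pi.inf_apply, e2, Pi.sup_apply, e3, Pi.smul_apply, e4, Pi.sub_apply, e5,
        Pi.smul_apply, e6, e7]
      simp
    refine hSlim _ u ((Lp.stronglyMeasurable f).measurable measurableSet_Ioi) huH
      (fun n => ?_) ?_
    · filter_upwards [hu n] with ω hω
      rw [hω, abs_le]
      exact ⟨by linarith [le_min (le_max_right ((n : ℝ) * (f ω - c)) 0) zero_le_one],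
        min_le_right _ _⟩
    · filter_upwards [ae_all_iff.2 hu] with ω hω
      simp only [hω]
      refine tendsto_const_nhds.congr' ?_
      by_cases h : c < f ω
      · have hpos : 0 < f ω - c := sub_pos.2 h
        filter_upwards [eventually_ge_atTop ⌈1 / (f ω - c)⌉₊] with n hn
        have : 1 ≤ (n : ℝ) * (f ω - c) := by
          rw [← div_le_iff₀ hpos]
          exact (Nat.le_ceil _).trans (by exact_mod_cast hn)
        rw [max_eq_left (by linarith), min_eq_right this]
        simp [h]
      · filter_upwards with n
        have h' : f ω - c ≤ 0 := by linarith [not_lt.1 h]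
        rw [max_eq_right (mul_nonpos_of_nonneg_of_nonpos (Nat.cast_nonneg _) h')]
        simp [h]
  -- If g is orthogonal to H, it integrates to zero over each set of G, so 𝔼(g|G) = 0 and g is
  -- orthogonal to every G-measurable f.
  · refine mem_of_forall_inner_eq_zero hc fun g hg => ?_
    have hz : condProj P hG g = 0 := by
      refine (condProj_eq_iff hG).2 ?_
      have h0 : (0 : Ω → ℝ) =ᵐ[P] P[g | G] := by
        refine ae_eq_condExp_of_forall_setIntegral_eq hG (integrable_of_L2 g)
          (fun _ _ _ => (integrable_zero _ _ _).integrableOn) ?_ aestronglyMeasurable_const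
        rintro A ⟨hA, u, hu, huA⟩ -
        have := hg u hu
        rw [inner_eq_integral] at this
        have e : ∫ ω in A, (0 : Ω → ℝ) ω ∂P = 0 := by simp
        rw [e, ← integral_indicator hA, ← this]
        refine integral_congr_ae ?_
        filter_upwards [huA] with ω hω
        rw [hω]
        by_cases h : ω ∈ A <;> simp [h]
      exact h0.symm.trans (Lp.coeFn_zero ℝ 2 P).symm
    rw [← (condProj_eq_self_iff hG).2 hf, inner_condProj_left, hz, inner_zero_right]

end Lattice

/-! ### Dependence of the spectral measure on f; spectral subspaces. -/

namespace ContinuousFactorization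

variable {Ω : Type*} {m₀ : MeasurableSpace Ω} {P : Measure Ω} [IsProbabilityMeasure P]
  (X : ContinuousFactorization P)

/-- A weighted parallelogram identity, in which the cross terms cancel. The free parameter allows
the coefficient of `X.spec f` to approach 1 when g has no mass on the set under consideration. -/
theorem spec_add_add_spec_sub (f g : Lp ℝ 2 P) {a : ℝ} (ha : a ≠ 0) :
    X.spec (f + g) + X.spec (a • f - a⁻¹ • g) =
      ENNReal.ofReal (1 + a ^ 2) • X.spec f + ENNReal.ofReal (1 + a⁻¹ ^ 2) • X.spec g := by
  refine ext_of_compactsIn fun E hE => ?_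
  have hE := hE.isTame
  simp only [Measure.coe_add, Measure.coe_smul, Pi.add_apply, Pi.smul_apply, smul_eq_mul,
    X.spec_compactsIn _ hE]
  rw [← ENNReal.ofReal_add (by positivity) (by positivity), ← ENNReal.ofReal_mul (by positivity),
    ← ENNReal.ofReal_mul (by positivity), ← ENNReal.ofReal_add (by positivity) (by positivity)]
  congr 1
  rw [map_add, map_sub, map_smul, map_smul, norm_add_sq_real, norm_sub_sq_real,
    real_inner_smul_left, real_inner_smul_right, norm_smul, norm_smul, mul_pow, mul_pow,
    Real.norm_eq_abs, Real.norm_eq_abs, sq_abs, sq_abs]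
  field_simp
  ring

theorem spec_smul (c : ℝ) (f : Lp ℝ 2 P) : X.spec (c • f) = ENNReal.ofReal (c ^ 2) • X.spec f := by
  refine ext_of_compactsIn fun E hE => ?_
  simp only [Measure.coe_smul, Pi.smul_apply, smul_eq_mul, X.spec_compactsIn _ hE.isTame]
  rw [← ENNReal.ofReal_mul (by positivity), map_smul, norm_smul, mul_pow, Real.norm_eq_abs, sq_abs]

theorem spec_neg (f : Lp ℝ 2 P) : X.spec (-f) = X.spec f := by
  have := X.spec_smul (-1) f
  simpa using this

theorem spec_add_le (f g : Lp ℝ 2 P) {a : ℝ} (ha : a ≠ 0) (A : Set (Compacts ℝ)) :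
    X.spec (f + g) A ≤
      ENNReal.ofReal (1 + a ^ 2) * X.spec f A + ENNReal.ofReal (1 + a⁻¹ ^ 2) * X.spec g A := by
  have := congrArg (fun μ : Measure (Compacts ℝ) => μ A) (X.spec_add_add_spec_sub f g ha)
  simp only [Measure.coe_add, Measure.coe_smul, Pi.add_apply, Pi.smul_apply, smul_eq_mul] at this
  rw [← this]
  exact le_self_add

theorem spec_add_le_of_null {f g : Lp ℝ 2 P} {A : Set (Compacts ℝ)} (h : X.spec g A = 0) :
    X.spec (f + g) A ≤ X.spec f A := by
  have h1 : ∀ a : ℝ, a ≠ 0 → X.spec (f + g) A ≤ ENNReal.ofReal (1 + a ^ 2) * X.spec f A :=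
    fun a ha => by simpa [h] using X.spec_add_le f g ha A
  have h2 : Tendsto (fun n : ℕ => ENNReal.ofReal (1 + (1 / ((n : ℝ) + 1)) ^ 2) * X.spec f A) atTop
      (𝓝 (ENNReal.ofReal (1 + 0 ^ 2) * X.spec f A)) :=
    ENNReal.Tendsto.mul_const (ENNReal.tendsto_ofReal
      ((tendsto_one_div_add_atTop_nhds_zero_nat.pow 2).const_add 1)) (Or.inl (by simp))
  simp only [ne_eq, OfNat.ofNat_ne_zero, not_false_eq_true, zero_pow, add_zero,
    ENNReal.ofReal_one, one_mul] at h2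
  exact ge_of_tendsto' h2 fun n => h1 _ (by positivity)

theorem spec_add_of_null {f g : Lp ℝ 2 P} {A : Set (Compacts ℝ)} (h : X.spec g A = 0) :
    X.spec (f + g) A = X.spec f A := by
  refine le_antisymm (X.spec_add_le_of_null h) ?_
  have := X.spec_add_le_of_null (f := f + g) (g := -g) (A := A) (by rwa [spec_neg])
  rwa [add_neg_cancel_right] at this

theorem spec_apply_le (f : Lp ℝ 2 P) (A : Set (Compacts ℝ)) :
    X.spec f A ≤ ENNReal.ofReal (‖f‖ ^ 2) :=
  (measure_mono (subset_univ A)).trans (X.spec_univ f).le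

/-- The elements of `L₂` whose spectral measure does not charge a given set. -/
noncomputable def nullSubspace (A : Set (Compacts ℝ)) : Submodule ℝ (Lp ℝ 2 P) where
  carrier := {f | X.spec f A = 0}
  add_mem' {f g} hf hg := (X.spec_add_of_null hg).trans hf
  zero_mem' := by
    refine le_antisymm ((X.spec_apply_le 0 A).trans ?_) zero_le
    simp
  smul_mem' c f hf := by
    have hf : X.spec f A = 0 := hf
    simp [spec_smul, hf]

/-- If u n does not charge A, then f and f - u n give A the same mass, at most ‖f - u n‖². -/
theorem isClosed_nullSubspace (A : Set (Compacts ℝ)) :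
    IsClosed (X.nullSubspace A : Set (Lp ℝ 2 P)) := by
  refine isClosed_of_closure_subset fun f hf => ?_
  obtain ⟨u, hu, hlim⟩ := mem_closure_iff_seq_limit.1 hf
  have h1 : ∀ n, X.spec f A ≤ ENNReal.ofReal (‖f - u n‖ ^ 2) := fun n => by
    have := X.spec_add_of_null (f := f - u n) (g := u n) (A := A) (hu n)
    rw [sub_add_cancel] at this
    exact this.le.trans (X.spec_apply_le _ A)
  have h2 : Tendsto (fun n => ENNReal.ofReal (‖f - u n‖ ^ 2)) atTop (𝓝 (ENNReal.ofReal (0 ^ 2))) := by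
    refine ENNReal.tendsto_ofReal (Tendsto.pow ?_ 2)
    have := (tendsto_const_nhds (x := f)).sub hlim
    rw [sub_self] at this
    simpa using this.norm
  exact le_antisymm (by simpa using ge_of_tendsto' h2 h1) zero_le

/-- On A only g contributes to the spectral measure of f ± g, and on the complement only f does. The
total mass is thus blind to the sign of g, so ‖f + g‖ = ‖f - g‖. -/
theorem inner_eq_zero_of_null {A : Set (Compacts ℝ)} (hA : MeasurableSet A) {f g : Lp ℝ 2 P}
    (hf : X.spec f A = 0) (hg : X.spec g Aᶜ = 0) : ⟪f, g⟫_ℝ = 0 := by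
  have key : ∀ g : Lp ℝ 2 P, X.spec g Aᶜ = 0 →
      X.spec (f + g) univ = X.spec g A + X.spec f Aᶜ := fun g hg => by
    rw [← measure_add_measure_compl hA, X.spec_add_of_null hg, add_comm f g,
      X.spec_add_of_null hf]
  have h : X.spec (f + g) univ = X.spec (f + -g) univ := by
    rw [key g hg, key (-g) (by rwa [spec_neg]), spec_neg]
  rw [spec_univ, spec_univ, ← sub_eq_add_neg,
    ENNReal.ofReal_eq_ofReal_iff (by positivity) (by positivity), norm_add_sq_real,
    norm_sub_sq_real] at h
  linarith

/-- Spectral decomposition with respect to a Borel set of compact sets. -/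
theorem exists_decomposition {A : Set (Compacts ℝ)} (hA : MeasurableSet A) :
    ∀ f : Lp ℝ 2 P, ∃ g h, f = g + h ∧ X.spec g Aᶜ = 0 ∧ X.spec h A = 0 := by
  induction A, hA using MeasurableSpace.induction_on_inter borel_compacts_eq
    isPiSystem_compactsIn with
  | empty => exact fun f => ⟨0, f, by simp, (X.nullSubspace _).zero_mem, measure_empty⟩
  | basic A hA =>
    obtain ⟨E, hE, rfl⟩ := hA
    have hE : IsTame E := IsElementary.isTame hE
    refine fun f => ⟨X.proj E f, f - X.proj E f, by simp, ?_, ?_⟩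
    · rw [measure_compl (measurableSet_compactsIn hE) (measure_ne_top _ _), spec_univ,
        X.spec_compactsIn _ hE, X.proj_proj_of_subset subset_rfl, tsub_self]
    · rw [X.spec_compactsIn _ hE, map_sub, X.proj_proj_of_subset subset_rfl]
      simp
  | compl A hA ih =>
    intro f
    obtain ⟨g, h, rfl, hg, hh⟩ := ih f
    exact ⟨h, g, add_comm _ _, by rwa [compl_compl], hg⟩
  | iUnion A _ hA ih =>
    intro f
    have : CompleteSpace (X.nullSubspace (⋃ i, A i)ᶜ) :=
      (X.isClosed_nullSubspace _).completeSpace_coe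
    -- Project orthogonally onto the subspace concentrated on the union. If the rest h charged some
    -- A i, its component u on A i would be a nonzero element of that subspace, while orthogonality
    -- to both h and h - u forces u = 0.
    obtain ⟨g, hg, h, hh, rfl⟩ := (X.nullSubspace (⋃ i, A i)ᶜ).exists_add_mem_mem_orthogonal f
    refine ⟨g, h, rfl, hg, measure_iUnion_null fun i => ?_⟩
    obtain ⟨u, v, rfl, hu, hv⟩ := ih i h
    have h1 : ⟪u, u + v⟫_ℝ = 0 := (Submodule.mem_orthogonal _ _).1 hh u
      (measure_mono_null (compl_subset_compl.2 (subset_iUnion A i)) hu)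
    have h2 : ⟪u, v⟫_ℝ = 0 := by
      rw [real_inner_comm]
      exact X.inner_eq_zero_of_null (hA i) hv hu
    rw [inner_add_right, h2, add_zero, inner_self_eq_zero] at h1
    rwa [h1, zero_add]

end ContinuousFactorization

/-! ### Finite sets, separated sets, and counting of hit cells. -/

section Separated

/-- The compact subsets of `[-(n+1), n+1)` whose points are at distances at least `1 / (n + 1)`. -/
def separatedSets (n : ℕ) : Set (Compacts ℝ) :=
  {M | (∀ x ∈ M, x ∈ Ico (-((n : ℝ) + 1)) (n + 1)) ∧
    ∀ x ∈ M, ∀ y ∈ M, x ≠ y → 1 / ((n : ℝ) + 1) ≤ |x - y|}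

theorem eventually_separated {T : Set ℝ} (hT : T.Finite) :
    ∀ᶠ n : ℕ in atTop, (∀ x ∈ T, x ∈ Ico (-((n : ℝ) + 1)) (n + 1)) ∧
      ∀ x ∈ T, ∀ y ∈ T, x ≠ y → 1 / ((n : ℝ) + 1) ≤ |x - y| := by
  refine .and ?_ ?_
  · refine (eventually_all_finite hT).2 fun x _ => ?_
    filter_upwards [eventually_ge_atTop ⌈|x|⌉₊] with n hn
    have h : |x| ≤ n := (Nat.le_ceil _).trans (by exact_mod_cast hn)
    have := abs_le.1 h
    exact ⟨by linarith, by linarith⟩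
  · refine (eventually_all_finite hT).2 fun x _ => (eventually_all_finite hT).2 fun y _ => ?_
    by_cases hxy : x = y
    · simp [hxy]
    · filter_upwards [(tendsto_one_div_add_atTop_nhds_zero_nat (𝕜 := ℝ)).eventually
        (gt_mem_nhds (abs_pos.2 (sub_ne_zero.2 hxy)))] with n hn _ using hn.le

theorem injOn_floor {n : ℕ} {T : Set ℝ}
    (hT : ∀ x ∈ T, ∀ y ∈ T, x ≠ y → 1 / ((n : ℝ) + 1) ≤ |x - y|) :
    InjOn (fun x : ℝ => ⌊((n : ℝ) + 1) * x⌋) T := fun x hx y hy hxy => by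
  by_contra hne
  exact (abs_sub_lt_of_mem_cell (n := n) (k := ⌊((n : ℝ) + 1) * y⌋) hxy rfl).not_ge (hT x hx y hy hne)

theorem floor_mem_cellIndices {n : ℕ} {x : ℝ} (hx : x ∈ Ico (-((n : ℝ) + 1)) (n + 1)) :
    ⌊((n : ℝ) + 1) * x⌋ ∈ cellIndices n :=
  mem_cellIndices (rfl : x ∈ cell n ⌊((n : ℝ) + 1) * x⌋) hx.1 hx.2

theorem finite_of_mem_separatedSets {n : ℕ} {M : Compacts ℝ} (hM : M ∈ separatedSets n) :
    (M : Set ℝ).Finite := by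
  refine Set.Finite.of_finite_image ((cellIndices n).finite_toSet.subset ?_) (injOn_floor hM.2)
  rintro _ ⟨x, hx, rfl⟩
  exact floor_mem_cellIndices (hM.1 x hx)

theorem setOf_finite_eq_iUnion :
    {M : Compacts ℝ | (M : Set ℝ).Finite} = ⋃ n, separatedSets n := by
  ext M
  rw [mem_iUnion]
  refine ⟨fun h => ?_, fun ⟨n, hn⟩ => finite_of_mem_separatedSets hn⟩
  exact (eventually_separated (T := (M : Set ℝ)) h).exists

theorem monotone_separatedSets : Monotone separatedSets := by
  intro i j hij M hM
  have hij' : (i : ℝ) ≤ j := by exact_mod_cast hij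
  refine ⟨fun x hx => ⟨?_, ?_⟩, fun x hx y hy hxy => le_trans ?_ (hM.2 x hx y hy hxy)⟩
  · linarith [(hM.1 x hx).1]
  · linarith [(hM.1 x hx).2]
  · gcongr

/-- Having two distinct points too close to each other is an open condition in the Vietoris
topology. -/
theorem measurableSet_separatedSets (n : ℕ) : MeasurableSet (separatedSets n) := by
  have h : IsOpen {M : Compacts ℝ | ∃ x ∈ M, ∃ y ∈ M, x ≠ y ∧ |x - y| < 1 / ((n : ℝ) + 1)} := by
    have hO : IsOpen {p : ℝ × ℝ | p.1 ≠ p.2 ∧ |p.1 - p.2| < 1 / ((n : ℝ) + 1)} :=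
      (isOpen_ne_fun continuous_fst continuous_snd).inter
        (isOpen_lt (continuous_fst.sub continuous_snd).abs continuous_const)
    refine isOpen_iff_forall_mem_open.2 ?_
    rintro M ⟨x, hx, y, hy, hxy⟩
    obtain ⟨U, V, hU, hV, hxU, hyV, hUV⟩ := isOpen_prod_iff.1 hO x y hxy
    refine ⟨{K | ((K : Set ℝ) ∩ U).Nonempty} ∩ {K | ((K : Set ℝ) ∩ V).Nonempty}, ?_,
      (Compacts.isOpen_inter_nonempty_of_isOpen hU).inter
        (Compacts.isOpen_inter_nonempty_of_isOpen hV), ⟨x, hx, hxU⟩, ⟨y, hy, hyV⟩⟩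
    rintro K ⟨⟨x', hx', hxU'⟩, ⟨y', hy', hyV'⟩⟩
    exact ⟨x', hx', y', hy', hUV (mk_mem_prod hxU' hyV')⟩
  have e : separatedSets n = compactsIn (Ico (-((n : ℝ) + 1)) (n + 1)) ∩
      {M : Compacts ℝ | ∃ x ∈ M, ∃ y ∈ M, x ≠ y ∧ |x - y| < 1 / ((n : ℝ) + 1)}ᶜ := by
    ext M
    refine and_congr Iff.rfl ?_
    simp only [mem_compl_iff, mem_ofPred_eq, not_exists, not_and, not_lt]
  rw [e]
  exact (measurableSet_compactsIn (.of_ordConnected ordConnected_Ico)).inter h.measurableSet.compl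

theorem measurableSet_setOf_finite : MeasurableSet {M : Compacts ℝ | (M : Set ℝ).Finite} := by
  rw [setOf_finite_eq_iUnion]
  exact .iUnion measurableSet_separatedSets

open Classical in
/-- The indices of the cells that meet a given set. -/
noncomputable def hits (n : ℕ) (M : Set ℝ) : Finset ℤ :=
  (cellIndices n).filter fun k => (M ∩ cell n k).Nonempty

theorem mem_hits {n : ℕ} {M : Set ℝ} {k : ℤ} :
    k ∈ hits n M ↔ k ∈ cellIndices n ∧ (M ∩ cell n k).Nonempty := by
  classical
  simp [hits]

/-- The bound does not depend on n: points chosen in different hit cells of grid n are different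
points of M, so by separation they occupy different cells of grid k. -/
theorem card_hits_le {n k : ℕ} {M : Compacts ℝ} (hM : M ∈ separatedSets k) :
    (hits n M).card ≤ (cellIndices k).card := by
  have h : ∀ j : ℤ, ∃ x : ℝ, j ∈ hits n M → x ∈ M ∧ x ∈ cell n j := fun j => by
    by_cases hj : j ∈ hits n M
    · obtain ⟨x, hx⟩ := (mem_hits.1 hj).2
      exact ⟨x, fun _ => hx⟩
    · exact ⟨0, fun h => (hj h).elim⟩
  choose x hx using h
  refine Finset.card_le_card_of_injOn (fun j => ⌊((k : ℝ) + 1) * x j⌋)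
    (fun j hj => floor_mem_cellIndices (hM.1 _ (hx j hj).1)) fun i hi j hj hij => ?_
  have := injOn_floor hM.2 (hx i hi).1 (hx j hj).1 hij
  rw [← (hx i hi).2, ← (hx j hj).2, this]

theorem tendsto_card_hits {M : Set ℝ} (hM : M.Infinite) :
    Tendsto (fun n => (hits n M).card) atTop atTop := by
  refine tendsto_atTop.2 fun m => ?_
  obtain ⟨T, hTM, hTm⟩ := hM.exists_subset_card_eq m
  filter_upwards [eventually_separated T.finite_toSet] with n hn
  rw [← hTm]
  exact Finset.card_le_card_of_injOn (fun x => ⌊((n : ℝ) + 1) * x⌋)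
    (fun x hx => mem_hits.2 ⟨floor_mem_cellIndices (hn.1 x hx), x, hTM hx, rfl⟩)
    (injOn_floor hn.2)

/-- The complement of the cells with indices outside a given set. -/
noncomputable def keepCells (n : ℕ) (S : Finset ℤ) : Set ℝ := (⋃ k ∈ cellIndices n \ S, cell n k)ᶜ

theorem isTame_keepCells (n : ℕ) (S : Finset ℤ) : IsTame (keepCells n S) :=
  (IsTame.biUnion _ fun _ _ => isTame_cell _ _).compl

theorem mem_compactsIn_keepCells {n : ℕ} {S : Finset ℤ} {M : Compacts ℝ} :
    M ∈ compactsIn (keepCells n S) ↔ hits n M ⊆ S := by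
  rw [compactsIn, mem_ofPred_eq, keepCells]
  constructor
  · intro h k hk
    obtain ⟨hk1, x, hxM, hxk⟩ := mem_hits.1 hk
    by_contra hkS
    exact h hxM (mem_iUnion₂.2 ⟨k, Finset.mem_sdiff.2 ⟨hk1, hkS⟩, hxk⟩)
  · intro h x hxM hx
    obtain ⟨k, hk, hxk⟩ := mem_iUnion₂.1 hx
    obtain ⟨hk1, hk2⟩ := Finset.mem_sdiff.1 hk
    exact hk2 (h (mem_hits.2 ⟨hk1, x, hxM, hxk⟩))

/-- Expand the product over the cells of a + b·1[cell not hit]. In probabilistic terms S is a random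
set keeping each cell with probability a, and the sum is the probability that all hit cells are
kept. The coefficients being nonnegative, inequalities on the events {M ⊆ E} pass to integrals of
the power. -/
theorem pow_card_hits (n : ℕ) {a b : ℝ≥0∞} (hab : a + b = 1) (M : Compacts ℝ) :
    a ^ (hits n M).card = ∑ S ∈ (cellIndices n).powerset,
      a ^ S.card * b ^ (cellIndices n \ S).card *
        (compactsIn (keepCells n S)).indicator 1 M := by
  classical
  have h1 : ∏ k ∈ cellIndices n, (a + if k ∈ hits n M then 0 else b) = a ^ (hits n M).card := by
    have : ∀ k ∈ cellIndices n, (a + if k ∈ hits n M then 0 else b) =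
        if k ∈ hits n M then a else 1 := fun k _ => by
      by_cases hk : k ∈ hits n M <;> simp [hk, hab]
    rw [Finset.prod_congr rfl this, Finset.prod_ite, Finset.prod_const, Finset.prod_const_one,
      mul_one]
    congr 2
    ext k
    simp only [Finset.mem_filter, and_iff_right_iff_imp]
    exact fun hk => (mem_hits.1 hk).1
  rw [← h1, Finset.prod_add]
  refine Finset.sum_congr rfl fun S hS => ?_
  rw [Finset.prod_const, mul_assoc]
  congr 1
  by_cases h : hits n M ⊆ S
  · rw [indicator_of_mem (mem_compactsIn_keepCells.2 h), Pi.one_apply, mul_one,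
      Finset.prod_congr rfl fun k hk => if_neg fun hk' => (Finset.mem_sdiff.1 hk).2 (h hk'),
      Finset.prod_const]
  · rw [indicator_of_notMem fun h' => h (mem_compactsIn_keepCells.1 h'), mul_zero]
    obtain ⟨k, hk, hkS⟩ := Finset.not_subset.1 h
    exact Finset.prod_eq_zero (Finset.mem_sdiff.2 ⟨(mem_hits.1 hk).1, hkS⟩) (if_pos hk)

theorem measurable_pow_card_hits (n : ℕ) {a b : ℝ≥0∞} (hab : a + b = 1) :
    Measurable fun M : Compacts ℝ => a ^ (hits n M).card := by
  simp only [pow_card_hits n hab]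
  exact Finset.measurable_sum _ fun S _ => ((measurable_one.indicator
    (measurableSet_compactsIn (isTame_keepCells n S))).const_mul _)

theorem lintegral_pow_card_hits (n : ℕ) {a b : ℝ≥0∞} (hab : a + b = 1)
    (μ : Measure (Compacts ℝ)) :
    ∫⁻ M, a ^ (hits n M).card ∂μ = ∑ S ∈ (cellIndices n).powerset,
      a ^ S.card * b ^ (cellIndices n \ S).card * μ (compactsIn (keepCells n S)) := by
  simp only [pow_card_hits n hab]
  have hm : ∀ S, MeasurableSet (compactsIn (keepCells n S)) := fun S =>
    measurableSet_compactsIn (isTame_keepCells n S)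
  rw [lintegral_finsetSum _ fun S _ => (measurable_one.indicator (hm S)).const_mul _]
  refine Finset.sum_congr rfl fun S _ => ?_
  rw [lintegral_const_mul _ (measurable_one.indicator (hm S)), lintegral_indicator_one (hm S)]

/-- If one measure dominates another one on all `{M : M ⊆ E}`, and the total masses are equal, then
the former is concentrated on finite sets whenever the latter is. -/
theorem finite_ae_of_compactsIn_le {μ ν : Measure (Compacts ℝ)} [IsFiniteMeasure μ]
    [IsFiniteMeasure ν] (hle : ∀ E, IsTame E → μ (compactsIn E) ≤ ν (compactsIn E))
    (huniv : ν univ = μ univ) (hμ : μ {M : Compacts ℝ | (M : Set ℝ).Finite}ᶜ = 0) :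
    ν {M : Compacts ℝ | (M : Set ℝ).Finite}ᶜ = 0 := by
  set F : Set (Compacts ℝ) := {M | (M : Set ℝ).Finite} with hF
  have hFm : MeasurableSet F := measurableSet_setOf_finite
  -- Compare the integrals of a^(number of hit cells). On `separatedSets k` the exponent is bounded
  -- uniformly in n; on infinite sets it tends to infinity, so they drop out as n → ∞.
  have h1 : ∀ (a : ℝ≥0∞) (k : ℕ), a < 1 →
      a ^ (cellIndices k).card * μ (separatedSets k) ≤ ν F := by
    intro a k ha
    have hab : a + (1 - a) = 1 := add_tsub_cancel_of_le ha.le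
    have hint : ∀ n, a ^ (cellIndices k).card * μ (separatedSets k) ≤
        ν F + ∫⁻ M in Fᶜ, a ^ (hits n M).card ∂ν := by
      intro n
      calc a ^ (cellIndices k).card * μ (separatedSets k)
          = ∫⁻ _ in separatedSets k, a ^ (cellIndices k).card ∂μ := by
            rw [setLIntegral_const]
        _ ≤ ∫⁻ M in separatedSets k, a ^ (hits n M).card ∂μ :=
            setLIntegral_mono (measurable_pow_card_hits n hab) fun M hM =>
              pow_le_pow_right_of_le_one' ha.le (card_hits_le hM)
        _ ≤ ∫⁻ M, a ^ (hits n M).card ∂μ := setLIntegral_le_lintegral _ _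
        _ ≤ ∫⁻ M, a ^ (hits n M).card ∂ν := by
            rw [lintegral_pow_card_hits n hab, lintegral_pow_card_hits n hab]
            exact Finset.sum_le_sum fun S _ => mul_le_mul_right (hle _ (isTame_keepCells n S)) _
        _ = (∫⁻ M in F, a ^ (hits n M).card ∂ν) + ∫⁻ M in Fᶜ, a ^ (hits n M).card ∂ν :=
            (lintegral_add_compl _ hFm).symm
        _ ≤ _ := by
            gcongr
            calc ∫⁻ M in F, a ^ (hits n M).card ∂ν ≤ ∫⁻ _ in F, 1 ∂ν :=
                  lintegral_mono fun M => pow_le_one' ha.le _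
              _ = ν F := by simp
    have hlim : Tendsto (fun n => ∫⁻ M in Fᶜ, a ^ (hits n M).card ∂ν) atTop (𝓝 0) := by
      have := tendsto_lintegral_of_dominated_convergence (μ := ν.restrict Fᶜ)
        (F := fun n (M : Compacts ℝ) => a ^ (hits n M).card) (f := fun _ => 0) (fun _ => 1)
        (fun n => measurable_pow_card_hits n hab)
        (fun n => ae_of_all _ fun M => pow_le_one' ha.le _) (by simp [measure_ne_top])
        ((ae_restrict_mem hFm.compl).mono fun M hM =>
          (ENNReal.tendsto_pow_atTop_nhds_zero_of_lt_one ha).comp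
            (tendsto_card_hits (M := (M : Set ℝ)) hM))
      simpa using this
    have := ge_of_tendsto' (tendsto_const_nhds.add hlim) hint
    rwa [add_zero] at this
  -- Let a increase to 1; the exponent is fixed by k.
  have h2 : ∀ k, μ (separatedSets k) ≤ ν F := by
    intro k
    have ht : Tendsto (fun a : ℝ≥0∞ => a ^ (cellIndices k).card * μ (separatedSets k)) (𝓝[<] 1)
        (𝓝 (1 ^ (cellIndices k).card * μ (separatedSets k))) :=
      (ENNReal.Tendsto.mul_const ((ENNReal.continuous_pow _).tendsto _)
        (Or.inl (by simp))).mono_left nhdsWithin_le_nhds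
    rw [one_pow, one_mul] at ht
    have : (𝓝[<] (1 : ℝ≥0∞)).NeBot := nhdsLT_neBot_of_exists_lt ⟨0, zero_lt_one⟩
    exact le_of_tendsto ht (eventually_nhdsWithin_of_forall fun a ha => h1 a k ha)
  have h3 : μ F ≤ ν F := by
    have hFU : F = ⋃ n, separatedSets n := setOf_finite_eq_iUnion
    rw [show μ F = _ from congrArg μ hFU, monotone_separatedSets.measure_iUnion]
    exact iSup_le h2
  rw [measure_compl hFm (measure_ne_top _ _), huniv, ← measure_add_measure_compl hFm, hμ, add_zero]
  exact tsub_eq_zero_of_le h3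

end Separated

/-! ### The stable σ-field. -/

namespace ContinuousFactorization

variable {Ω : Type*} {m₀ : MeasurableSpace Ω} {P : Measure Ω} [IsProbabilityMeasure P]
  (X : ContinuousFactorization P)

theorem norm_proj_le_norm_proj_abs (E : Set ℝ) (f : Lp ℝ 2 P) : ‖X.proj E f‖ ≤ ‖X.proj E |f|‖ := by
  refine Lp.norm_le_norm_of_ae_le ?_
  filter_upwards [coeFn_condProj (X.fieldOn_le E) f, coeFn_condProj (X.fieldOn_le E) |f|,
    abs_condExp_ae_le_condExp_abs (m := X.fieldOn E) (μ := P) f,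
    condExp_congr_ae (m := X.fieldOn E) (Lp.coeFn_abs f)] with ω h1 h2 h3 h4
  change ‖condProj P (X.fieldOn_le E) f ω‖ ≤ ‖condProj P (X.fieldOn_le E) |f| ω‖
  rw [h1, h2, Real.norm_eq_abs, Real.norm_eq_abs, h4]
  exact le_trans h3 (le_abs_self _)

theorem isStable_iff {f : Lp ℝ 2 P} :
    X.IsStable f ↔ X.spec f {M : Compacts ℝ | (M : Set ℝ).Finite}ᶜ = 0 :=
  X.mem_spectralSubspace

theorem isSensitive_iff {f : Lp ℝ 2 P} :
    X.IsSensitive f ↔ X.spec f {M : Compacts ℝ | (M : Set ℝ).Finite} = 0 := by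
  have : {M : Compacts ℝ | (M : Set ℝ).Infinite}ᶜ = {M : Compacts ℝ | (M : Set ℝ).Finite} := by
    ext M
    exact not_infinite
  rw [← this]
  exact X.mem_spectralSubspace

/-- The decisive property of the stable subspace. Passing from f to |f| keeps the total spectral
mass and increases the mass of every event {M ⊆ E}. -/
theorem isStable_abs {f : Lp ℝ 2 P} (hf : X.IsStable f) : X.IsStable |f| := by
  rw [isStable_iff] at hf ⊢
  refine finite_ae_of_compactsIn_le (fun E hE => ?_) ?_ hf
  · rw [X.spec_compactsIn _ hE, X.spec_compactsIn _ hE]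
    gcongr
    exact X.norm_proj_le_norm_proj_abs E f
  · rw [spec_univ, spec_univ, norm_abs_eq_norm]

theorem isStable_const : X.IsStable (Lp.const 2 P (1 : ℝ)) := by
  rw [isStable_iff]
  have h : X.proj ∅ (Lp.const 2 P (1 : ℝ)) = Lp.const 2 P (1 : ℝ) :=
    (condProj_eq_self_iff _).2 (aestronglyMeasurable_const.congr (Lp.coeFn_const 2 P (1 : ℝ)).symm)
  have hsub : {M : Compacts ℝ | (M : Set ℝ).Finite}ᶜ ⊆ (compactsIn ∅)ᶜ :=
    compl_subset_compl.2 fun M hM => finite_empty.subset hM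
  refine measure_mono_null hsub ?_
  rw [measure_compl (measurableSet_compactsIn .empty) (measure_ne_top _ _), spec_univ,
    X.spec_compactsIn _ .empty, h, tsub_self]

theorem exists_isStableField : ∃ G : MeasurableSpace Ω, X.IsStableField G := by
  set F : Set (Compacts ℝ) := {M | (M : Set ℝ).Finite} with hF
  have hFm : MeasurableSet F := measurableSet_setOf_finite
  obtain ⟨G, hG, h⟩ := exists_measurableSpace_of_abs_mem (X.nullSubspace Fᶜ)
    (X.isClosed_nullSubspace _) (X.isStable_iff.1 X.isStable_const)
    fun f hf => X.isStable_iff.1 (X.isStable_abs (X.isStable_iff.2 hf))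
  refine ⟨G, hG, fun f => X.isStable_iff.trans (h f), fun f => X.isSensitive_iff.trans ?_⟩
  have hz : P[f | G] =ᵐ[P] 0 ↔ condProj P hG f = 0 := by
    rw [condProj_eq_iff]
    exact ⟨fun h => h.trans (Lp.coeFn_zero ℝ 2 P).symm, fun h => h.trans (Lp.coeFn_zero ℝ 2 P)⟩
  rw [hz]
  have hmem : ∀ f, condProj P hG f ∈ X.nullSubspace Fᶜ := fun f =>
    (h _).2 (aestronglyMeasurable_condProj hG f)
  constructor
  · intro hf
    have h1 := X.inner_eq_zero_of_null hFm hf (hmem f)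
    rw [real_inner_comm, inner_condProj_self] at h1
    exact norm_eq_zero.1 (pow_eq_zero_iff two_ne_zero |>.1 h1)
  · intro hf
    -- The stable component g of f is orthogonal to f, because 𝔼(f|G) = 0, and to the sensitive
    -- component k; hence it vanishes.
    obtain ⟨g, k, rfl, hg, hk⟩ := X.exists_decomposition hFm f
    have hg' : condProj P hG g = g := (condProj_eq_self_iff hG).2 ((h g).1 hg)
    have h1 : ⟪g, g + k⟫_ℝ = 0 := by
      rw [← hg', inner_condProj_left, hg', hf, inner_zero_right]
    have h2 := X.inner_eq_zero_of_null hFm hk hg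
    rw [inner_add_right, real_inner_comm k g, h2, add_zero, inner_self_eq_zero] at h1
    rwa [h1, zero_add]

end ContinuousFactorization

/-! ### σ-fields generated by subsets of L₂. -/

section GeneratedField

variable {Ω : Type*} {m : MeasurableSpace Ω} {m₀ : MeasurableSpace Ω} {P : Measure Ω}
  {S T : Set (Lp ℝ 2 P)}

theorem generatedField_le : generatedField S ≤ m₀ :=
  MeasurableSpace.generateFrom_le fun _ hA => hA.1

theorem generatedField_mono (h : S ⊆ T) : generatedField S ≤ generatedField T :=
  MeasurableSpace.generateFrom_mono fun _ hA =>
    ⟨hA.1, hA.2.choose, h hA.2.choose_spec.1, hA.2.choose_spec.2⟩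

theorem generatedField_le_nullCompletion (h : ∀ f ∈ S, AEStronglyMeasurable[m] f P) :
    generatedField S ≤ nullCompletion P m := by
  refine MeasurableSpace.generateFrom_le ?_
  rintro A ⟨hA, f, hf, B, hB, hAB⟩
  obtain ⟨g, hg, hfg⟩ := h f hf
  refine measurableSet_nullCompletion.2 ⟨hA, g ⁻¹' B, hg.measurable hB, hAB.trans ?_⟩
  filter_upwards [hfg] with ω hω
  exact propext (show f ω ∈ B ↔ g ω ∈ B by rw [hω])

theorem aestronglyMeasurable_generatedField {f : Lp ℝ 2 P} (hf : f ∈ S) :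
    AEStronglyMeasurable[generatedField S] f P := by
  refine StronglyMeasurable.aestronglyMeasurable (Measurable.stronglyMeasurable ?_)
  intro B hB
  exact MeasurableSpace.measurableSet_generateFrom
    ⟨(Lp.stronglyMeasurable f).measurable hB, f, hf, B, hB, EventuallyEq.rfl⟩

end GeneratedField

/-! ### Multiplication by indicators. -/

section Cut

variable {Ω : Type*} {m : MeasurableSpace Ω} {m₀ : MeasurableSpace Ω} {P : Measure Ω}

/-- The product of an element of `L₂` with an indicator. -/
noncomputable def cut {b : Set Ω} (hb : MeasurableSet b) (f : Lp ℝ 2 P) : Lp ℝ 2 P :=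
  ((Lp.memLp f).indicator hb).toLp _

theorem coeFn_cut {b : Set Ω} (hb : MeasurableSet b) (f : Lp ℝ 2 P) :
    cut hb f =ᵐ[P] b.indicator f := MemLp.coeFn_toLp _

theorem cut_add {b : Set Ω} (hb : MeasurableSet b) (f g : Lp ℝ 2 P) :
    cut hb (f + g) = cut hb f + cut hb g := by
  refine Lp.ext ?_
  filter_upwards [coeFn_cut hb (f + g), coeFn_cut hb f, coeFn_cut hb g,
    Lp.coeFn_add (cut hb f) (cut hb g), Lp.coeFn_add f g] with ω h1 h2 h3 h4 h5
  rw [h1, h4, Pi.add_apply, h2, h3]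
  by_cases h : ω ∈ b
  · rw [indicator_of_mem h, indicator_of_mem h, indicator_of_mem h, h5, Pi.add_apply]
  · simp [h]

theorem aestronglyMeasurable_cut {b : Set Ω} (hb : MeasurableSet b) (hbm : MeasurableSet[m] b)
    {f : Lp ℝ 2 P} (hf : AEStronglyMeasurable[m] f P) : AEStronglyMeasurable[m] (cut hb f) P := by
  obtain ⟨g, hg, hfg⟩ := hf
  refine ⟨b.indicator g, hg.indicator hbm, (coeFn_cut hb f).trans ?_⟩
  filter_upwards [hfg] with ω hω
  by_cases h : ω ∈ b <;> simp [h, hω]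

end Cut

theorem ae_bdd_condExp_indicator {Ω : Type*} (m : MeasurableSpace Ω) {m₀ : MeasurableSpace Ω} {P : Measure Ω}
     (a b : Set Ω) :
    ∀ᵐ ω ∂P, ‖b.indicator (P[a.indicator (1 : Ω → ℝ) | m]) ω‖ ≤ 1 := by
  have := ae_bdd_norm_condExp_of_ae_bdd_norm (m := m) (μ := P) (R := 1)
    (f := a.indicator (1 : Ω → ℝ)) (ae_of_all _ fun ω => by by_cases hω : ω ∈ a <;> simp [hω])
  filter_upwards [this] with ω hω
  by_cases hω' : ω ∈ b
  · simpa [hω'] using hω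
  · simp [hω']

theorem Iio_inter_Ioi_self {α : Type*} [Preorder α] (t : α) : Iio t ∩ Ioi t = ∅ :=
  eq_empty_of_forall_notMem fun _ h => lt_asymm h.1 h.2

/-! ### The first chaos generates the stable σ-field. -/

namespace ContinuousFactorization

variable {Ω : Type*} {m₀ : MeasurableSpace Ω} {P : Measure Ω} (X : ContinuousFactorization P)

/-- The σ-field generated by the part of the first chaos that lives on `c`. -/
@[reducible]
noncomputable def chaosField (c : Set ℝ) : MeasurableSpace Ω :=
  generatedField (X.chaos 1 ∩ {g | AEStronglyMeasurable[X.fieldOn c] g P})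

theorem chaosField_le (c : Set ℝ) : X.chaosField c ≤ m₀ := generatedField_le

theorem chaosField_le_nullCompletion (c : Set ℝ) :
    X.chaosField c ≤ nullCompletion P (X.fieldOn c) :=
  generatedField_le_nullCompletion fun _ hf => hf.2

theorem chaosField_le_generatedField (c : Set ℝ) :
    X.chaosField c ≤ generatedField (X.chaos 1) := generatedField_mono inter_subset_left

variable [IsProbabilityMeasure P]

theorem proj_eq_self_iff {E : Set ℝ} {f : Lp ℝ 2 P} :
    X.proj E f = f ↔ AEStronglyMeasurable[X.fieldOn E] f P := condProj_eq_self_iff _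

theorem proj_empty_eq_zero_iff {f : Lp ℝ 2 P} : X.proj ∅ f = 0 ↔ ∫ ω, f ω ∂P = 0 := by
  rw [proj, condProj_eq_iff, fieldOn_empty, condExp_bot]
  constructor
  · intro h
    have := integral_congr_ae (h.trans (Lp.coeFn_zero ℝ 2 P))
    simpa using this
  · intro h
    rw [h]
    exact (Lp.coeFn_zero ℝ 2 P).symm

theorem inner_proj_proj {E F : Set ℝ} (hE : IsTame E) (hF : IsTame F) (f : Lp ℝ 2 P) :
    ⟪X.proj E f, X.proj F f⟫_ℝ = ‖X.proj (E ∩ F) f‖ ^ 2 := by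
  have h := inner_condProj_left (X.fieldOn_le E) f (X.proj F f)
  change ⟪X.proj E f, X.proj F f⟫_ℝ = ⟪f, X.proj E (X.proj F f)⟫_ℝ at h
  rw [h, X.proj_proj hE hF, real_inner_comm]
  exact inner_condProj_self _ f

theorem norm_sub_proj_sub_proj_sq {E F : Set ℝ} (hE : IsTame E) (hF : IsTame F) {f : Lp ℝ 2 P}
    (hEF : X.proj (E ∩ F) f = 0) :
    ‖f - X.proj E f - X.proj F f‖ ^ 2 = ‖f‖ ^ 2 - (‖X.proj E f‖ ^ 2 + ‖X.proj F f‖ ^ 2) := by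
  have h1 : ∀ G : Set ℝ, ⟪f, X.proj G f⟫_ℝ = ‖X.proj G f‖ ^ 2 := fun G => by
    rw [real_inner_comm]; exact inner_condProj_self _ f
  have h2 := X.inner_proj_proj hE hF f
  rw [hEF, norm_zero, zero_pow two_ne_zero] at h2
  rw [norm_sub_sq_real, norm_sub_sq_real, inner_sub_left, h1, h1, h2]
  ring

/-- Two complementary formulations of orthogonal additivity of `f` over two tame sets. -/
theorem spec_compl_union_eq_zero_iff {E F : Set ℝ} (hE : IsTame E) (hF : IsTame F) {f : Lp ℝ 2 P}
    (hEF : X.proj (E ∩ F) f = 0) :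
    X.spec f (compactsIn E ∪ compactsIn F)ᶜ = 0 ↔ X.proj E f + X.proj F f = f := by
  have hEm := measurableSet_compactsIn hE
  have hFm := measurableSet_compactsIn hF
  have h0 : X.spec f (compactsIn E ∩ compactsIn F) = 0 := by
    rw [← compactsIn_inter, X.spec_compactsIn _ (hE.inter hF), hEF]
    simp
  have hu := measure_union_add_inter (μ := X.spec f) (compactsIn E) hFm
  rw [h0, add_zero, X.spec_compactsIn _ hE, X.spec_compactsIn _ hF,
    ← ENNReal.ofReal_add (by positivity) (by positivity)] at hu
  have hn := X.norm_sub_proj_sub_proj_sq hE hF hEF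
  have hle : 0 ≤ ‖f‖ ^ 2 - (‖X.proj E f‖ ^ 2 + ‖X.proj F f‖ ^ 2) := hn ▸ sq_nonneg _
  rw [measure_compl (hEm.union hFm) (measure_ne_top _ _), spec_univ, hu,
    ← ENNReal.ofReal_sub _ (by positivity), ENNReal.ofReal_eq_zero, ← hn]
  constructor
  · intro h
    have h' : ‖f - X.proj E f - X.proj F f‖ = 0 := by
      have := le_antisymm h (sq_nonneg _)
      exact pow_eq_zero_iff two_ne_zero |>.1 this
    rw [norm_eq_zero, sub_sub, sub_eq_zero] at h'
    exact h'.symm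
  · intro h
    rw [sub_sub, h, sub_self]
    simp

/-- A fixed point t is almost never in the spectral set, since removing it from the line does not
change the closure. -/
theorem spec_mem_eq_zero (f : Lp ℝ 2 P) (t : ℝ) : X.spec f (compactsIn {t}ᶜ)ᶜ = 0 := by
  have ht : IsTame {t}ᶜ := (IsTame.of_ordConnected ordConnected_singleton).compl
  have h : X.proj {t}ᶜ f = f := by
    rw [← X.proj_closure ht, closure_compl_singleton, proj_univ]
  rw [measure_compl (measurableSet_compactsIn ht) (measure_ne_top _ _), spec_univ,
    X.spec_compactsIn _ ht, h, tsub_self]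

/-- Additivity at t forces almost every M to lie strictly on one side of t. Two points of M would be
separated by a rational t, and only countably many null sets are discarded. -/
theorem mem_chaos_one_of_forall {f : Lp ℝ 2 P} (h0 : X.proj ∅ f = 0)
    (h : ∀ t : ℝ, X.proj (Iio t) f + X.proj (Ioi t) f = f) : f ∈ X.chaos 1 := by
  refine X.mem_spectralSubspace.2 ?_
  have h1 : X.spec f (compactsIn ∅) = 0 := by
    rw [X.spec_compactsIn _ .empty, h0]
    simp
  have h2 : ∀ t : ℝ, X.spec f (compactsIn (Iio t) ∪ compactsIn (Ioi t))ᶜ = 0 := fun t => by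
    refine (X.spec_compl_union_eq_zero_iff (.of_ordConnected ordConnected_Iio)
      (.of_ordConnected ordConnected_Ioi) ?_).2 (h t)
    rwa [Iio_inter_Ioi_self]
  refine measure_mono_null ?_ (measure_union_null h1
    (measure_iUnion_null fun q : ℚ => h2 q))
  intro M hM
  by_contra hcon
  rw [mem_union, mem_iUnion, not_or, not_exists] at hcon
  obtain ⟨hne, hq⟩ := hcon
  refine hM ?_
  have hne' : (M : Set ℝ).Nonempty := by
    by_contra h'
    exact hne (not_nonempty_iff_eq_empty.1 h').subset
  rw [mem_ofPred_eq, Nat.cast_one, encard_eq_one]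
  refine (exists_eq_singleton_iff_nonempty_subsingleton.2 ⟨hne', fun x hx y hy => ?_⟩)
  have key : ∀ x ∈ M, ∀ y ∈ M, ¬x < y := by
    intro x hx y hy hxy
    obtain ⟨q, hxq, hqy⟩ := exists_rat_btwn hxy
    rcases not_not.1 (hq q) with h' | h'
    · exact absurd (h' hy) (not_lt.2 hqy.le)
    · exact absurd (h' hx) (not_lt.2 hxq.le)
  exact le_antisymm (not_lt.1 (key y hy x hx)) (not_lt.1 (key x hx y hy))

/-- If almost all spectral sets have at most one point in `c`, then the component of `f`
orthogonal to `L₂(𝓕_{cᶜ})` is additive over the two parts of `c` on the sides of a point. -/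
theorem proj_add_proj_eq_of_subsingleton {c : Set ℝ} (hc : IsTame c) {f : Lp ℝ 2 P}
    (hf : X.spec f {M | ¬((M : Set ℝ) ∩ c).Subsingleton} = 0) (hf0 : X.proj cᶜ f = 0) (t : ℝ) :
    X.proj (c ∩ Iio t ∪ cᶜ) f + X.proj (c ∩ Ioi t ∪ cᶜ) f = f := by
  have h1 : IsTame (c ∩ Iio t ∪ cᶜ) :=
    (hc.inter (.of_ordConnected ordConnected_Iio)).union hc.compl
  have h2 : IsTame (c ∩ Ioi t ∪ cᶜ) :=
    (hc.inter (.of_ordConnected ordConnected_Ioi)).union hc.compl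
  have h12 : (c ∩ Iio t ∪ cᶜ) ∩ (c ∩ Ioi t ∪ cᶜ) = cᶜ := by
    rw [← inter_union_distrib_right, inter_inter_inter_comm, Iio_inter_Ioi_self, inter_empty,
      empty_union]
  refine (X.spec_compl_union_eq_zero_iff h1 h2 (by rwa [h12])).1 ?_
  refine measure_mono_null ?_ (measure_union_null hf (X.spec_mem_eq_zero f t))
  intro M hM
  by_contra hcon
  rw [mem_union, not_or] at hcon
  have hsub : ((M : Set ℝ) ∩ c).Subsingleton := not_not.1 hcon.1
  have ht : ∀ x ∈ M, x ≠ t := not_not.1 hcon.2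
  refine hM ?_
  by_cases hx : ∃ x ∈ (M : Set ℝ) ∩ c, x < t
  · obtain ⟨x, hx, hxt⟩ := hx
    refine Or.inl fun y hy => ?_
    by_cases hyc : y ∈ c
    · exact Or.inl ⟨hyc, by rw [hsub ⟨hy, hyc⟩ hx]; exact hxt⟩
    · exact Or.inr hyc
  · refine Or.inr fun y hy => ?_
    by_cases hyc : y ∈ c
    · exact Or.inl ⟨hyc, lt_of_le_of_ne (not_lt.1 fun h => hx ⟨y, ⟨hy, hyc⟩, h⟩) (ht y hy).symm⟩
    · exact Or.inr hyc

theorem integral_cut_eq_zero {E : Set ℝ} {f : Lp ℝ 2 P} (hf : X.proj E f = 0) {b : Set Ω}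
    (hb : MeasurableSet[X.fieldOn E] b) : ∫ ω, cut (X.fieldOn_le E _ hb) f ω ∂P = 0 := by
  rw [integral_congr_ae (coeFn_cut _ f), integral_indicator (X.fieldOn_le E _ hb),
    ← setIntegral_condExp (X.fieldOn_le E) (integrable_of_L2 f) hb,
    setIntegral_congr_ae (X.fieldOn_le E _ hb)
      (((condProj_eq_iff (X.fieldOn_le E)).1 hf).mono fun _ h _ => h),
    setIntegral_congr_ae (X.fieldOn_le E _ hb) ((Lp.coeFn_zero ℝ 2 P).mono fun _ h _ => h)]
  simp

theorem proj_empty_proj_cut {c : Set ℝ} {f : Lp ℝ 2 P} (hf : X.proj cᶜ f = 0) {b : Set Ω}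
    (hb : MeasurableSet[X.fieldOn cᶜ] b) :
    X.proj ∅ (X.proj c (cut (X.fieldOn_le cᶜ _ hb) f)) = 0 := by
  rw [X.proj_proj_of_subset (empty_subset c), proj_empty_eq_zero_iff]
  exact X.integral_cut_eq_zero hf hb

/-- Multiplication by 1_b followed by projection to c integrates out 𝓕_{cᶜ}; what remains depends on
d alone. -/
theorem aestronglyMeasurable_proj_cut {c d : Set ℝ} (hc : IsTame c) (hd : IsTame d) (hdc : d ⊆ c)
    {f : Lp ℝ 2 P} (hf : AEStronglyMeasurable[X.fieldOn (d ∪ cᶜ)] f P) {b : Set Ω}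
    (hb : MeasurableSet[X.fieldOn cᶜ] b) :
    AEStronglyMeasurable[X.fieldOn d] (X.proj c (cut (X.fieldOn_le cᶜ _ hb) f)) P := by
  have hle : X.fieldOn d ⊔ X.fieldOn cᶜ ≤ m₀ := sup_le (X.fieldOn_le _) (X.fieldOn_le _)
  have h1 : AEStronglyMeasurable[X.fieldOn d ⊔ X.fieldOn cᶜ] (cut (X.fieldOn_le cᶜ _ hb) f) P :=
    aestronglyMeasurable_cut _ ((le_sup_right : X.fieldOn cᶜ ≤ X.fieldOn d ⊔ X.fieldOn cᶜ) _ hb)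
      (hf.of_le_nullCompletion hle (X.fieldOn_union_le hd hc.compl) (integrable_of_L2 f))
  have h2 := condExp_sup_of_indep (B' := ⊥) (X.fieldOn_le c) (X.fieldOn_le cᶜ)
    (X.indep_fieldOn hc disjoint_compl_right) (X.fieldOn_mono hdc) bot_le (integrable_of_L2 _) h1
  rw [sup_bot_eq, sup_bot_eq] at h2
  exact stronglyMeasurable_condExp.aestronglyMeasurable.congr
    (h2.trans (coeFn_condProj (X.fieldOn_le c) _).symm)

/-- Partial integration over `𝓕_{cᶜ}` sends such components to the first chaos. -/
theorem proj_cut_mem_chaos {c : Set ℝ} (hc : IsTame c) {f : Lp ℝ 2 P}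
    (hf : X.spec f {M | ¬((M : Set ℝ) ∩ c).Subsingleton} = 0) (hf0 : X.proj cᶜ f = 0) {b : Set Ω}
    (hb : MeasurableSet[X.fieldOn cᶜ] b) :
    X.proj c (cut (X.fieldOn_le cᶜ _ hb) f) ∈ X.chaos 1 := by
  refine X.mem_chaos_one_of_forall (X.proj_empty_proj_cut hf0 hb) fun t => ?_
  have h1 : IsTame (c ∩ Iio t) := hc.inter (.of_ordConnected ordConnected_Iio)
  have h2 : IsTame (c ∩ Ioi t) := hc.inter (.of_ordConnected ordConnected_Ioi)
  -- Both halves of f turn into centred functions living on their own side of t, so each half-line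
  -- projection keeps one and kills the other.
  have hpart : ∀ d : Set ℝ, IsTame d → d ⊆ c → ∀ g, g = X.proj (d ∪ cᶜ) f →
      X.proj d (X.proj c (cut (X.fieldOn_le cᶜ _ hb) g)) =
        X.proj c (cut (X.fieldOn_le cᶜ _ hb) g) ∧
      X.proj ∅ (X.proj c (cut (X.fieldOn_le cᶜ _ hb) g)) = 0 := by
    rintro d hd hdc g rfl
    refine ⟨X.proj_eq_self_iff.2 (X.aestronglyMeasurable_proj_cut hc hd hdc
      (aestronglyMeasurable_condProj _ f) hb), X.proj_empty_proj_cut ?_ hb⟩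
    rw [X.proj_proj_of_subset subset_union_right, hf0]
  obtain ⟨ha1, ha2⟩ := hpart _ h1 inter_subset_left _ rfl
  obtain ⟨hb1, hb2⟩ := hpart _ h2 inter_subset_left _ rfl
  have hsum := X.proj_add_proj_eq_of_subsingleton hc hf hf0 t
  set f₁ := X.proj (c ∩ Iio t ∪ cᶜ) f
  set f₂ := X.proj (c ∩ Ioi t ∪ cᶜ) f
  rw [← hsum, cut_add, map_add]
  set g₁ := X.proj c (cut (X.fieldOn_le cᶜ _ hb) f₁)
  set g₂ := X.proj c (cut (X.fieldOn_le cᶜ _ hb) f₂)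
  have e1 : X.proj (Iio t) g₁ = g₁ := by
    rw [← ha1, X.proj_proj_of_subset' inter_subset_right]
  have e2 : X.proj (Ioi t) g₂ = g₂ := by
    rw [← hb1, X.proj_proj_of_subset' inter_subset_right]
  have e3 : X.proj (Iio t) g₂ = 0 := by
    rw [← e2, X.proj_proj (.of_ordConnected ordConnected_Iio) (.of_ordConnected ordConnected_Ioi),
      Iio_inter_Ioi_self, hb2]
  have e4 : X.proj (Ioi t) g₁ = 0 := by
    rw [← e1, X.proj_proj (.of_ordConnected ordConnected_Ioi) (.of_ordConnected ordConnected_Iio),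
      inter_comm, Iio_inter_Ioi_self, ha2]
  rw [map_add, map_add, e1, e2, e3, e4, add_zero, zero_add]

theorem chaosField_mono {c d : Set ℝ} (h : c ⊆ d) : X.chaosField c ≤ X.chaosField d :=
  generatedField_mono fun _ hf => ⟨hf.1, AEStronglyMeasurable.of_le_nullCompletion (X.fieldOn_le d)
    (X.fieldOn_mono' h) (integrable_of_L2 _) hf.2⟩

/-- Test on a ∩ b with a over c and b over cᶜ: the integral of f is that over a of 𝔼(1_b f|𝓕_c).
This function is in the first chaos on c, so a matters only through 𝔼(1_a|K). -/
theorem aestronglyMeasurable_of_subsingleton_of_proj_eq_zero {c : Set ℝ} (hc : IsTame c)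
    {f : Lp ℝ 2 P} (hf : X.spec f {M | ¬((M : Set ℝ) ∩ c).Subsingleton} = 0)
    (hf0 : X.proj cᶜ f = 0) :
    AEStronglyMeasurable[X.chaosField c ⊔ X.fieldOn cᶜ] f P := by
  set A := nullCompletion P (X.fieldOn c) with hA
  set B := X.fieldOn cᶜ with hB
  set K := X.chaosField c with hK
  have hA0 : A ≤ m₀ := nullCompletion_le
  have hB0 : B ≤ m₀ := X.fieldOn_le _
  have hKA : K ≤ A := X.chaosField_le_nullCompletion c
  have hK0 : K ≤ m₀ := X.chaosField_le c
  have hfi := integrable_of_L2 f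
  have hind : Indep A B P := (X.indep_fieldOn hc disjoint_compl_right).of_le_nullCompletion le_rfl
    (le_nullCompletion hB0)
  have hfull : P[f | A ⊔ B] =ᵐ[P] f := by
    refine (aestronglyMeasurable_iff_condExp (sup_le hA0 hB0) hfi).1 ?_
    refine (Lp.aestronglyMeasurable f).of_le_nullCompletion (sup_le hA0 hB0) ?_ hfi
    refine X.le_fieldOn_univ.trans (nullCompletion_le_of_le ?_)
    have := X.fieldOn_union_le hc hc.compl
    rw [union_compl_self] at this
    exact this.trans (nullCompletion_mono (sup_le hA0 hB0)
      (sup_le_sup_right (le_nullCompletion (X.fieldOn_le c)) _))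
  suffices h : P[f | K ⊔ B] =ᵐ[P] P[f | A ⊔ B] from
    stronglyMeasurable_condExp.aestronglyMeasurable.congr (h.trans hfull)
  refine ae_eq_condExp_of_isPiSystem (sup_le hA0 hB0) sup_eq_generateFrom_interSets
    isPiSystem_interSets univ_mem_interSets hfi integrable_condExp
    (stronglyMeasurable_condExp.mono (sup_le_sup_right hKA B)).aestronglyMeasurable ?_
  rintro _ ⟨a, ha, b, hb, rfl⟩
  simp only [mem_ofPred_eq] at ha hb ⊢
  have ha0 := hA0 _ ha
  have hb0 := hB0 _ hb
  have hab : MeasurableSet[m₀] (a ∩ b) := ha0.inter hb0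
  have hint : ∀ s, MeasurableSet[m₀] s → Integrable (s.indicator (1 : Ω → ℝ)) P := fun s hs =>
    (integrable_const (1 : ℝ)).indicator hs
  have eind : ∀ (s : Set Ω) (g : Ω → ℝ),
      (fun ω => g ω * s.indicator (1 : Ω → ℝ) ω) = s.indicator g := fun s g => by
    ext ω; by_cases hω : ω ∈ s <;> simp [hω]
  set v : Ω → ℝ := P[a.indicator (1 : Ω → ℝ) | K] with hv
  have hvK : StronglyMeasurable[K] v := stronglyMeasurable_condExp
  have hu : StronglyMeasurable[K ⊔ B] (b.indicator v) :=
    (hvK.mono le_sup_left).indicator ((le_sup_right : B ≤ K ⊔ B) _ hb)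
  have h1 : ∫ ω in a ∩ b, (P[f | K ⊔ B]) ω ∂P = ∫ ω, f ω * b.indicator v ω ∂P := by
    have e1 := integral_mul_condExp (f := P[f | K ⊔ B]) (g := (a ∩ b).indicator (1 : Ω → ℝ))
      (sup_le hK0 hB0)
      stronglyMeasurable_condExp.aestronglyMeasurable (hint _ hab)
      (by rw [Pi.mul_def, eind]; exact integrable_condExp.indicator hab)
    rw [eind, integral_indicator hab] at e1
    rw [← e1]
    have e2 := integral_mul_condExp (sup_le hK0 hB0) hu.aestronglyMeasurable hfi
      (hfi.bdd_mul (c := 1) (hu.mono (sup_le hK0 hB0)).aestronglyMeasurable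
        (ae_bdd_condExp_indicator K a b))
    simp only [mul_comm (f _)]
    rw [← e2]
    refine integral_congr_ae ?_
    filter_upwards [condExp_indicator_inter_of_indep hA0 hB0 hind hKA ha hb] with ω hω
    rw [← hω, mul_comm]
  have h2 : ∫ ω in a ∩ b, f ω ∂P = ∫ ω, f ω * b.indicator v ω ∂P := by
    set g := X.proj c (cut hb0 f) with hg
    have hgK : AEStronglyMeasurable[K] g P := aestronglyMeasurable_generatedField
      ⟨X.proj_cut_mem_chaos hc hf hf0 hb, aestronglyMeasurable_condProj _ _⟩
    have hcond : P[cut hb0 f | A] =ᵐ[P] g :=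
      (condExp_nullCompletion (X.fieldOn_le c) (integrable_of_L2 _)).trans
        (coeFn_condProj (X.fieldOn_le c) _).symm
    have hgi := integrable_of_L2 g
    have hva : AEStronglyMeasurable[m₀] v P := (hvK.mono hK0).aestronglyMeasurable
    have hvb : ∀ᵐ ω ∂P, ‖v ω‖ ≤ 1 := by
      filter_upwards [ae_bdd_condExp_indicator K a univ] with ω hω
      simpa using hω
    have hci := integrable_of_L2 (cut hb0 f)
    calc ∫ ω in a ∩ b, f ω ∂P = ∫ ω in a, cut hb0 f ω ∂P := by
          rw [setIntegral_congr_ae ha0 ((coeFn_cut hb0 f).mono fun _ h _ => h),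
            setIntegral_indicator hb0]
      _ = ∫ ω in a, (P[cut hb0 f | A]) ω ∂P := (setIntegral_condExp hA0 hci ha).symm
      _ = ∫ ω in a, g ω ∂P := setIntegral_congr_ae ha0 (hcond.mono fun _ h _ => h)
      _ = ∫ ω, g ω * a.indicator (1 : Ω → ℝ) ω ∂P := by rw [eind, integral_indicator ha0]
      _ = ∫ ω, g ω * v ω ∂P := (integral_mul_condExp hK0 hgK (hint _ ha0)
          (by rw [Pi.mul_def, eind]; exact hgi.indicator ha0)).symm
      _ = ∫ ω, v ω * (P[cut hb0 f | A]) ω ∂P := by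
          refine integral_congr_ae ?_
          filter_upwards [hcond] with ω hω
          rw [hω, mul_comm]
      _ = ∫ ω, v ω * cut hb0 f ω ∂P := integral_mul_condExp hA0
          (hvK.mono hKA).aestronglyMeasurable hci (hci.bdd_mul (c := 1) hva hvb)
      _ = ∫ ω, f ω * b.indicator v ω ∂P := by
          refine integral_congr_ae ?_
          filter_upwards [coeFn_cut hb0 f] with ω hω
          rw [hω]
          by_cases h : ω ∈ b <;> simp [h, mul_comm]
  rw [h1, h2]

theorem spec_proj_eq_zero {E : Set ℝ} (hE : IsTame E) (f : Lp ℝ 2 P) :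
    X.spec (X.proj E f) (compactsIn E)ᶜ = 0 := by
  rw [measure_compl (measurableSet_compactsIn hE) (measure_ne_top _ _), spec_univ,
    X.spec_compactsIn _ hE, X.proj_proj_of_subset subset_rfl, tsub_self]

theorem aestronglyMeasurable_of_subsingleton {c : Set ℝ} (hc : IsTame c)
    {f : Lp ℝ 2 P} (hf : X.spec f {M | ¬((M : Set ℝ) ∩ c).Subsingleton} = 0) :
    AEStronglyMeasurable[X.chaosField c ⊔ X.fieldOn cᶜ] f P := by
  have h1 : X.spec (X.proj cᶜ f) {M | ¬((M : Set ℝ) ∩ c).Subsingleton} = 0 := by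
    refine measure_mono_null (t := (compactsIn cᶜ)ᶜ) (fun M hM hM' => hM ?_)
      (X.spec_proj_eq_zero hc.compl f)
    have hM : (M : Set ℝ) ⊆ cᶜ := hM'
    rw [(disjoint_compl_left.mono_left hM).inter_eq]
    exact subsingleton_empty
  have h2 := X.aestronglyMeasurable_of_subsingleton_of_proj_eq_zero hc
    (f := f - X.proj cᶜ f) ((X.nullSubspace _).sub_mem hf h1)
    (by rw [map_sub, X.proj_proj_of_subset subset_rfl, sub_self])
  have h3 : AEStronglyMeasurable[X.chaosField c ⊔ X.fieldOn cᶜ] (X.proj cᶜ f) P :=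
    (aestronglyMeasurable_condProj _ f).mono le_sup_right
  refine (h2.add h3).congr ?_
  filter_upwards [Lp.coeFn_sub f (X.proj cᶜ f)] with ω hω
  rw [Pi.add_apply, hω, Pi.sub_apply, sub_add_cancel]

/-- Let C be the cells already treated, c the next one, W the σ-field over the rest. Then f is
measurable both for K_C ∨ W ∨ 𝓕_c and for 𝓕_C ∨ W ∨ K_c, where K is the first-chaos σ-field. As 𝓕_C
∨ W and 𝓕_c are independent, `condExp_sup_of_indep` yields K_C ∨ W ∨ K_c. -/
theorem aestronglyMeasurable_biUnion {ι : Type*} [DecidableEq ι] {D : ι → Set ℝ}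
    (hdisj : Pairwise (Function.onFun Disjoint D)) (hD : ∀ i, IsTame (D i)) {f : Lp ℝ 2 P}
    (hf : ∀ i, AEStronglyMeasurable[X.chaosField (D i) ⊔ X.fieldOn (D i)ᶜ] f P) (s : Finset ι) :
    AEStronglyMeasurable[X.chaosField (⋃ i ∈ s, D i) ⊔ X.fieldOn (⋃ i ∈ s, D i)ᶜ] f P := by
  have hfi := integrable_of_L2 f
  induction s using Finset.induction_on with
  | empty =>
    have e : (⋃ i ∈ (∅ : Finset ι), D i) = ∅ := by simp
    rw [e, compl_empty]
    have hle := sup_le (X.chaosField_le ∅) (X.fieldOn_le univ)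
    exact (Lp.aestronglyMeasurable f).of_le_nullCompletion hle
      (X.le_fieldOn_univ.trans (nullCompletion_mono hle le_sup_right)) hfi
  | insert a s ha ih =>
    rw [Finset.set_biUnion_insert]
    set C := ⋃ i ∈ s, D i with hC
    set c := D a with hc
    have hCt : IsTame C := .biUnion _ fun i _ => hD i
    have hct : IsTame c := hD a
    have hdC : Disjoint C c := disjoint_iUnion₂_left.2 fun i hi =>
      hdisj (by rintro rfl; exact ha hi)
    set W := X.fieldOn (c ∪ C)ᶜ with hW
    have hWt : IsTame (c ∪ C)ᶜ := (hct.union hCt).compl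
    have hW0 : W ≤ m₀ := X.fieldOn_le _
    set FC := nullCompletion P (X.fieldOn C) with hFC
    set Fc := nullCompletion P (X.fieldOn c) with hFc
    have hFC0 : FC ≤ m₀ := nullCompletion_le
    have hFc0 : Fc ≤ m₀ := nullCompletion_le
    have hCK : X.chaosField C ≤ FC := X.chaosField_le_nullCompletion C
    have hcK : X.chaosField c ≤ Fc := X.chaosField_le_nullCompletion c
    have hWc : W ≤ X.fieldOn cᶜ := X.fieldOn_mono (compl_subset_compl.2 subset_union_left)
    have hind : Indep (FC ⊔ W) Fc P := by
      refine (X.indep_fieldOn hct disjoint_compl_right).symm.of_le_nullCompletion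
        (sup_le ?_ (hWc.trans (le_nullCompletion (X.fieldOn_le _)))) le_rfl
      exact nullCompletion_mono (X.fieldOn_le _)
        (X.fieldOn_mono (disjoint_left.1 hdC))
    have hle1 : X.chaosField C ⊔ W ⊔ Fc ≤ m₀ := sup_le (sup_le (X.chaosField_le _) hW0) hFc0
    have h1 : AEStronglyMeasurable[X.chaosField C ⊔ W ⊔ Fc] f P := by
      suffices h : X.chaosField C ⊔ X.fieldOn Cᶜ ≤ nullCompletion P (X.chaosField C ⊔ W ⊔ Fc) from
        AEStronglyMeasurable.of_le_nullCompletion hle1 h hfi ih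
      refine sup_le ?_ ?_
      · exact (le_sup_left.trans le_sup_left).trans (le_nullCompletion hle1)
      · have e : Cᶜ = c ∪ (c ∪ C)ᶜ := by
          rw [compl_union, union_inter_distrib_left, union_compl_self, univ_inter]
          exact (union_eq_right.2 fun x hx hx' => disjoint_left.1 hdC hx' hx).symm
        rw [e]
        refine (X.fieldOn_union_le hct hWt).trans (nullCompletion_mono hle1 (sup_le ?_ ?_))
        · exact (le_nullCompletion (X.fieldOn_le c)).trans le_sup_right
        · exact le_sup_right.trans le_sup_left
    have hle2 : FC ⊔ W ⊔ X.chaosField c ≤ m₀ := sup_le (sup_le hFC0 hW0) (X.chaosField_le _)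
    have h2 : AEStronglyMeasurable[FC ⊔ W ⊔ X.chaosField c] f P := by
      suffices h : X.chaosField c ⊔ X.fieldOn cᶜ ≤ nullCompletion P (FC ⊔ W ⊔ X.chaosField c) from
        AEStronglyMeasurable.of_le_nullCompletion hle2 h hfi (hf a)
      refine sup_le ?_ ?_
      · exact le_sup_right.trans (le_nullCompletion hle2)
      · have e : cᶜ = C ∪ (c ∪ C)ᶜ := by
          rw [compl_union, union_inter_distrib_left, union_compl_self, inter_univ]
          exact (union_eq_right.2 fun x hx => disjoint_left.1 hdC hx).symm
        rw [e]
        refine (X.fieldOn_union_le hCt hWt).trans (nullCompletion_mono hle2 (sup_le ?_ ?_))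
        · exact (le_nullCompletion (X.fieldOn_le C)).trans (le_sup_left.trans le_sup_left)
        · exact le_sup_right.trans le_sup_left
    have h3 := condExp_sup_of_indep (sup_le hFC0 hW0) hFc0 hind (sup_le_sup_right hCK W) hcK hfi h1
    have h4 : AEStronglyMeasurable[X.chaosField C ⊔ W ⊔ X.chaosField c] f P :=
      stronglyMeasurable_condExp.aestronglyMeasurable.congr
        (h3.trans ((aestronglyMeasurable_iff_condExp hle2 hfi).1 h2))
    suffices h : X.chaosField C ⊔ W ⊔ X.chaosField c ≤ X.chaosField (c ∪ C) ⊔ W from h4.mono h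
    refine sup_le (sup_le ?_ le_sup_right) ?_
    · exact (X.chaosField_mono subset_union_right).trans le_sup_left
    · exact (X.chaosField_mono subset_union_left).trans le_sup_left

theorem aestronglyMeasurable_of_separatedSets {n : ℕ} {f : Lp ℝ 2 P}
    (hf : X.spec f (separatedSets n)ᶜ = 0) :
    AEStronglyMeasurable[generatedField (X.chaos 1)] f P := by
  have hfi := integrable_of_L2 f
  set C := ⋃ k ∈ cellIndices n, cell n k with hC
  have hCt : IsTame C := .biUnion _ fun k _ => isTame_cell n k
  have h1 : AEStronglyMeasurable[X.chaosField C ⊔ X.fieldOn Cᶜ] f P := by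
    refine X.aestronglyMeasurable_biUnion (disjoint_cell n) (isTame_cell n) (fun k => ?_) _
    refine X.aestronglyMeasurable_of_subsingleton (isTame_cell n k) (measure_mono_null ?_ hf)
    refine fun M hM hM' => hM fun x hx y hy => ?_
    by_contra hxy
    exact (abs_sub_lt_of_mem_cell hx.2 hy.2).not_ge (hM'.2 x hx.1 y hy.1 hxy)
  have h2 : AEStronglyMeasurable[nullCompletion P (X.fieldOn C)] f P := by
    refine AEStronglyMeasurable.mono (le_nullCompletion (X.fieldOn_le C)) ?_
    rw [← proj_eq_self_iff]
    have h0 : X.spec f (compactsIn C)ᶜ = 0 :=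
      measure_mono_null (compl_subset_compl.2 fun M hM x hx =>
        mem_iUnion₂.2 ⟨_, floor_mem_cellIndices (hM.1 x hx), rfl⟩) hf
    rw [measure_compl (measurableSet_compactsIn hCt) (measure_ne_top _ _), spec_univ,
      X.spec_compactsIn _ hCt, ← ENNReal.ofReal_sub _ (by positivity), ENNReal.ofReal_eq_zero] at h0
    have h3 := norm_sub_condProj_sq (X.fieldOn_le C) f
    change ‖f - X.proj C f‖ ^ 2 = ‖f‖ ^ 2 - ‖X.proj C f‖ ^ 2 at h3
    rw [← h3] at h0
    have := pow_eq_zero_iff two_ne_zero |>.1 (le_antisymm h0 (sq_nonneg _))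
    exact (sub_eq_zero.1 (norm_eq_zero.1 this)).symm
  -- The spectral sets lie inside C, so f is 𝓕_C-measurable and the independent factor 𝓕_{Cᶜ} can be
  -- dropped.
  have h3 := condExp_sup_of_indep (B' := ⊥) nullCompletion_le (X.fieldOn_le Cᶜ)
    ((X.indep_fieldOn hCt disjoint_compl_right).of_le_nullCompletion le_rfl
      (le_nullCompletion (X.fieldOn_le _))) (X.chaosField_le_nullCompletion C) bot_le hfi h1
  rw [sup_bot_eq, sup_bot_eq] at h3
  have h4 : AEStronglyMeasurable[X.chaosField C] f P :=
    stronglyMeasurable_condExp.aestronglyMeasurable.congr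
      (h3.trans ((aestronglyMeasurable_iff_condExp nullCompletion_le hfi).1 h2))
  exact h4.mono (X.chaosField_le_generatedField C)

/-- Argue by duality: if u is orthogonal to all functions measurable for the generated σ-field, then
its component on each `separatedSets n` vanishes, so u is sensitive and orthogonal to f. -/
theorem IsStable.aestronglyMeasurable {f : Lp ℝ 2 P} (hf : X.IsStable f) :
    AEStronglyMeasurable[generatedField (X.chaos 1)] f P := by
  set V : Submodule ℝ (Lp ℝ 2 P) := lpMeas ℝ ℝ (generatedField (X.chaos 1)) 2 P
  have hV : IsClosed (V : Set (Lp ℝ 2 P)) := isClosed_aestronglyMeasurable generatedField_le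
  suffices h : f ∈ V from h
  refine mem_of_forall_inner_eq_zero hV fun u hu => ?_
  have hz : ∀ n, X.spec u (separatedSets n) = 0 := by
    intro n
    obtain ⟨g, h, rfl, hg, hh⟩ := X.exists_decomposition (measurableSet_separatedSets n) u
    have h1 := hu g (X.aestronglyMeasurable_of_separatedSets hg)
    have h2 := X.inner_eq_zero_of_null (measurableSet_separatedSets n) hh hg
    rw [inner_add_right, real_inner_comm h g, h2, add_zero, inner_self_eq_zero] at h1
    rwa [h1, zero_add]
  rw [real_inner_comm]
  refine X.inner_eq_zero_of_null measurableSet_setOf_finite ?_ (X.isStable_iff.1 hf)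
  rw [setOf_finite_eq_iUnion]
  exact measure_iUnion_null hz

theorem isStable_of_mem_chaos {n : ℕ} {f : Lp ℝ 2 P} (hf : f ∈ X.chaos n) : X.IsStable f := by
  refine X.isStable_iff.2 (measure_mono_null (compl_subset_compl.2 fun M hM => ?_)
    (X.mem_spectralSubspace.1 hf))
  exact finite_of_encard_eq_coe hM

theorem IsStableField.eqModNull {X : ContinuousFactorization P} {G : MeasurableSpace Ω}
    (hG : X.IsStableField G) : EqModNull P (generatedField (X.chaos 1)) G := by
  refine eqModNull_of_le (generatedField_le_nullCompletion fun f hf =>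
    (hG.stable_iff f).1 (X.isStable_of_mem_chaos hf)) fun A hA => ?_
  have hA0 := hG.le _ hA
  have hI := indicatorConstLp_coeFn (p := 2) (hs := hA0) (hμs := measure_ne_top P A) (c := (1 : ℝ))
  have h1 : AEStronglyMeasurable[G] (indicatorConstLp 2 hA0 (measure_ne_top P A) (1 : ℝ)) P :=
    ⟨A.indicator fun _ => 1, stronglyMeasurable_const.indicator hA, hI⟩
  obtain ⟨g, hg, hfg⟩ := IsStable.aestronglyMeasurable X ((hG.stable_iff _).2 h1)
  refine measurableSet_nullCompletion.2
    ⟨hA0, g ⁻¹' {1}, hg.measurable (measurableSet_singleton 1), ?_⟩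
  filter_upwards [hI, hfg] with ω e1 e2
  refine propext (show ω ∈ A ↔ g ω ∈ ({1} : Set ℝ) from ?_)
  rw [mem_singleton_iff, ← e2, e1]
  by_cases h : ω ∈ A <;> simp [h]

end ContinuousFactorization

theorem mainTheorem6 {Ω : Type*} [MeasurableSpace Ω] (P : Measure Ω) [IsProbabilityMeasure P]
    (X : ContinuousFactorization P) :
    (∀ f : Lp ℝ 2 P, ∃! μ : Measure (Compacts ℝ), X.IsSpectralMeasure f μ) ∧
    (∃ G : MeasurableSpace Ω, X.IsStableField G) ∧
    (∀ G : MeasurableSpace Ω, X.IsStableField G →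
      EqModNull P (generatedField (X.chaos 1)) G) :=
  ⟨X.existsUnique_isSpectralMeasure, X.exists_isStableField, fun _ hG => hG.eqModNull⟩
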